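/- Let $G$ be a countably infinite group, and let $(F_n)_{n\ge 0}$ be a sequence of finite subsets of $G$ such that: (a) it is right Følner, that is, $\lim_{n\to\infty}|F_n g\setminus F_n|/|F_n|=0$ for every $g\in G$; (b) every $F_n$ is a left monotile, that is, there is $C\subseteq G$ such that $\{cF_n : c\in C\}$ is a partition of $G$; (c) it is congruent, that is, $1_G\in F_0$ and for every $n\ge 0$ there is $J_n\subseteq G$ with $1_G\in J_n$ such that $\{cF_n: c\in J_n\}$ is a partition of $F_{n+1}$; (d) it is exhaustive, that is, $G=\bigcup_{n\ge 0}F_n$. Let $(k_n)_{n\ge 0}$ be integers with $k_n\ge 2$, and for every $n\ge 0$ let $M_n$ be a $k_n\times k_{n+1}$ matrix with nonnegative integer entries such that $\sum_{i=1}^{k_n}M_n(i,j)=|F_{n+1}|/|F_n|$ for every $1\le j\le k_{n+1}$ (one says that $(M_n)$ is managed by $(|F_n|)$). Suppose that there is $K>0$ such that $k_{n+1}\le K\,|F_{n+1}|/|F_n|$ for every $n\ge 0$. For integers $k,p\ge 1$ let $\Delta(k,p)=\{x\in[0,\infty)^k:\sum_{i=1}^k x_i=1/p\}$, and let $$\varprojlim_n(\Delta(k_n,|F_n|),M_n)=\Big\{(z_n)_{n\ge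 0}\in\prod_{n\ge 0}\Delta(k_n,|F_n|): z_n=M_nz_{n+1}\ \text{for all } n\ge 0\Big\}$$ with the topology induced by the product topology. Then there exist a finite alphabet $\Sigma$ and a $G$-subshift $X\subseteq\Sigma^G$ (a nonempty closed subset of $\Sigma^G$ invariant under the action $\sigma^g(x)(h)=x(g^{-1}h)$) such that: (1) $X$ is minimal: every orbit $\{\sigma^g(x):g\in G\}$, $x\in X$, is dense in $X$; (2) $X$ is free on a full measure set: there is $A\subseteq X$ whose complement in $X$ is negligible for every shift-invariant Borel probability measure on $X$, such that $\sigma^g(x)=x$ with $x\in A$ implies $g=1_G$; (3) if $G$ is virtually abelian (it has an abelian subgroup of finite index), then $X$ is free: $\sigma^g(x)=x$ with $x\in X$ implies $g=1_G$; (4) the set of shift-invariant Borel probability measures on $X$, with the weak-$*$ topology, is affinely homeomorphic to $\varprojlim_n(\Delta(k_n,|F_n|),M_n)$. -/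

import Mathlib

open MeasureTheory Filter Topology
open scoped Pointwise

/-! ### Congruent monotileable amenable groups -/

/-- The left translates `c F`, for `c ∈ C`, form a partition of `S`. -/
def LeftTranslatesPartition {G : Type*} [Group G] (C F S : Set G) : Prop :=
  C.PairwiseDisjoint (fun c => c • F) ∧ ⋃ c ∈ C, c • F = S

/-- A finite subset `F` of `G` is a left monotile if some family of its left translates
partitions `G`. -/
def IsLeftMonotile {G : Type*} [Group G] (F : Finset G) : Prop :=
  ∃ C : Set G, LeftTranslatesPartition C (F : Set G) Set.univ

/-- Right Følner sequences: `|F_n g \ F_n| / |F_n| → 0` for every `g`. -/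
def IsRightFolner {G : Type*} [Group G] (F : ℕ → Finset G) : Prop :=
  ∀ g : G, Tendsto
    (fun n => ((((fun h => h * g) '' (F n : Set G)) \ (F n : Set G)).ncard : ℝ) / ((F n).card : ℝ))
    atTop (𝓝 0)

/-- Congruent sequences: `1 ∈ F_0`, and every `F_{n+1}` is partitioned by left translates `c F_n`,
`c ∈ J_n`, with `1 ∈ J_n`. -/
def IsCongruentSeq {G : Type*} [Group G] (F : ℕ → Finset G) : Prop :=
  1 ∈ F 0 ∧
    ∀ n, ∃ J : Set G, 1 ∈ J ∧ LeftTranslatesPartition J (F n : Set G) (F (n + 1) : Set G)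

/-- A congruent and exhaustive right Følner sequence made of left monotiles. -/
structure IsCongruentMonotileSeq {G : Type*} [Group G] (F : ℕ → Finset G) : Prop where
  folner : IsRightFolner F
  monotile : ∀ n, IsLeftMonotile (F n)
  congruent : IsCongruentSeq F
  exhaustive : ⋃ n, (F n : Set G) = Set.univ

/-- `G` has an abelian subgroup of finite index. -/
def IsVirtuallyAbelian (G : Type*) [Group G] : Prop :=
  ∃ Γ : Subgroup G, Γ.FiniteIndex ∧ ∀ a ∈ Γ, ∀ b ∈ Γ, a * b = b * a

/-! ### Subshifts -/

/-- The shift action of `G` on functions on `G`: `(σ^g x)(h) = x (g⁻¹ h)`. -/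
def shift {G : Type*} [Group G] {A : Type*} (g : G) (x : G → A) : G → A :=
  fun h => x (g⁻¹ * h)

/-- A `G`-subshift over the alphabet `Fin m` (with the discrete topology): a closed subset of
`(Fin m)^G`, with the product topology, which is invariant by the shift action. -/
structure Subshift (G : Type*) [Group G] (m : ℕ) where
  carrier : Set (G → Fin m)
  isClosed : IsClosed carrier
  shift_mem : ∀ (g : G), ∀ x ∈ carrier, shift g x ∈ carrier

namespace Subshift

/-- The shift `σ^g` as a self-map of the subshift. -/
def shiftMap {G : Type*} [Group G] {m : ℕ} (X : Subshift G m) (g : G) (x : X.carrier) :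
    X.carrier :=
  ⟨shift g x.1, X.shift_mem g x.1 x.2⟩

/-- The subshift is nonempty and every orbit is dense in it. -/
def IsMinimal {G : Type*} [Group G] {m : ℕ} (X : Subshift G m) : Prop :=
  X.carrier.Nonempty ∧ ∀ x : X.carrier, Dense (Set.range fun g : G => X.shiftMap g x)

/-- The shift action is free on the subset `S` of the subshift. -/
def IsFreeOn {G : Type*} [Group G] {m : ℕ} (X : Subshift G m) (S : Set X.carrier) : Prop :=
  ∀ x ∈ S, ∀ g : G, X.shiftMap g x = x → g = 1

/-- The invariant Borel probability measures of the subshift. As a subset of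
`ProbabilityMeasure X.carrier`, this set carries the topology of weak convergence. (`G` is countable,
so that the product `σ`-algebra is the Borel one.) -/
def invariantMeasures {G : Type*} [Group G] {m : ℕ} (X : Subshift G m) :
    Set (ProbabilityMeasure X.carrier) :=
  {μ | ∀ (g : G) (s : Set X.carrier), MeasurableSet s →
    (μ : Measure X.carrier) (X.shiftMap g '' s) = (μ : Measure X.carrier) s}

/-- `S` is a full measure set: its complement is negligible for every invariant measure. -/
def IsFullMeasure {G : Type*} [Group G] {m : ℕ} (X : Subshift G m) (S : Set X.carrier) : Prop :=
  ∀ μ ∈ X.invariantMeasures, (μ : Measure X.carrier) Sᶜ = 0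

end Subshift

/-! ### Managed sequences of matrices and their inverse limits -/

/-- The sequence of nonnegative integer matrices `M_n`, of size `k_n × k_{n+1}`, is managed by the
sequence `p`. -/
structure IsManaged (p k : ℕ → ℕ)
    (M : ∀ n, Matrix (Fin (k n)) (Fin (k (n + 1))) ℕ) : Prop where
  two_le : ∀ n, 2 ≤ k n
  column_sum : ∀ n (j : Fin (k (n + 1))),
    ((∑ i, M n i j : ℕ) : ℝ) = (p (n + 1) : ℝ) / (p n : ℝ)

/-- The simplex `Δ(k, p)` of the vectors in `ℝ^k` with nonnegative entries of sum `1 / p`. -/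
def scaledSimplex (k p : ℕ) : Set (Fin k → ℝ) :=
  {x | (∀ i, 0 ≤ x i) ∧ ∑ i, x i = 1 / (p : ℝ)}

/-- The inverse limit of the simplices `Δ(k_n, p_n)` under the maps `M_n`, a subset of the product
space `∏ n, ℝ^{k_n}`. -/
def inverseLimit (p k : ℕ → ℕ) (M : ∀ n, Matrix (Fin (k n)) (Fin (k (n + 1))) ℕ) :
    Set (∀ n, Fin (k n) → ℝ) :=
  {z | (∀ n, z n ∈ scaledSimplex (k n) (p n)) ∧
    ∀ n, z n = ((M n).map (Nat.cast : ℕ → ℝ)).mulVec (z (n + 1))}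

/-- A set of probability measures (with the topology of weak convergence) is affinely homeomorphic
to a subset `K` of a real topological vector space: there is a homeomorphism that respects convex
combinations. -/
def AffinelyHomeomorphic {Ω : Type*} [MeasurableSpace Ω] [TopologicalSpace Ω]
    [OpensMeasurableSpace Ω] (S : Set (ProbabilityMeasure Ω))
    {V : Type*} [AddCommGroup V] [Module ℝ V] [TopologicalSpace V] (K : Set V) : Prop :=
  ∃ e : S ≃ₜ K, ∀ (μ ν ρ : S) (t : ℝ), 0 ≤ t → t ≤ 1 →
    ((ρ : ProbabilityMeasure Ω) : Measure Ω) =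
      ENNReal.ofReal t • ((μ : ProbabilityMeasure Ω) : Measure Ω) +
        ENNReal.ofReal (1 - t) • ((ν : ProbabilityMeasure Ω) : Measure Ω) →
    (e ρ : V) = t • (e μ : V) + (1 - t) • (e ν : V)

-- The subshift is the orbit closure of a hierarchical tiling. Along a fast subsequence `m`, each
-- tile `F (m (n + 1))` is cut into translates of `F (m n)`, and the label of a tile determines the
-- labels of its subtiles. Among the subtiles of a tile, exactly the one at the identity carries the
-- root label. This makes the tiling recognizable: the letters of a point determine its tiles of
-- every level and their labels (`tile_unique`, `Tile.label_unique`). It also makes the subshift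
-- minimal, since every tile of level `n + 1` contains the pattern of the root tile of level `n`.
--
-- Measures. A non-root label contains an index in `Fin (k (m n))`. The subtiles of a tile of index
-- `l` are labelled so that the indices occur almost as often as prescribed by column `l` of the
-- product of the matrices between the levels `m n` and `m (n + 1)`, with relative error `(1/2)^n`
-- (`exists_labelling`, `Realizes`). Under an invariant measure the frequencies of tiles satisfy
-- exact linear equations (`freq_step`). Summed over the labels of each index, they solve the
-- equations of the inverse limit up to summable errors, so they shadow exactly one exact solution
-- (`IsApproxSolution.exists_shadows`, `Shadows.unique`). The resulting map is continuous and
-- affine. It is injective because the index sums determine all frequencies and, by the Følner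
-- property, these determine the measure; it is surjective by taking limits of empirical measures.
-- The bound on `k` makes the number of labels negligible compared with the number of subtiles, so
-- that a few subtiles can encode the label of their parent.
--
-- Freeness. If `g` fixes `x`, and `a` and `g a` lie in the same tile of `x`, then `g = 1`
-- (`shift_eq_of_same_tile`). With `a = 1`, the Følner property provides such a tile for almost
-- every `x`. If `G` is virtually abelian, let `Γ` be an abelian normal subgroup of finite index.
-- The labels also carry two colours in `G ⧸ Γ`, taken from the position in the interior of the
-- parent and transmitted by the parent near its boundary; they force `g ∈ Γ` (`mem_of_shift_eq`).
-- Then `g` has finitely many conjugates, and a tile large enough to contain them all contains both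
-- its base point and the image of this point by `g`.

universe u

/-! ### Hierarchical tilings with labels -/

/-- A substitution-like system of labelled tiles: the tile `F (n + 1)` is partitioned by the
translates `d F n`, `d ∈ J n`, and a tile of level `n + 1` with label `j` carries the label
`w n j d` on its subtile at `d`. The label `root n` marks the subtile at the identity. -/
structure TileSystem (G : Type u) [Group G] where
  F : ℕ → Finset G
  J : ℕ → Finset G
  L : ℕ → Type u
  fin : ∀ n, Fintype (L n)
  w : ∀ n, L (n + 1) → G → L n
  root : ∀ n, L n
  alph : ℕ
  enc : L 0 → G → Fin alph
  one_mem_F_zero : 1 ∈ F 0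
  one_mem_J : ∀ n, 1 ∈ J n
  mul_mem : ∀ n, ∀ d ∈ J n, ∀ f ∈ F n, d * f ∈ F (n + 1)
  exists_mul : ∀ n, ∀ h ∈ F (n + 1), ∃ d ∈ J n, d⁻¹ * h ∈ F n
  mul_inj : ∀ n, ∀ d ∈ J n, ∀ d' ∈ J n, ∀ h, d⁻¹ * h ∈ F n → d'⁻¹ * h ∈ F n → d = d'
  exhaust : ∀ g, ∃ n, g ∈ F n
  enc_inj : ∀ j j', ∀ f ∈ F 0, ∀ f' ∈ F 0, enc j f = enc j' f' → j = j' ∧ f = f'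
  w_root : ∀ n j, ∀ d ∈ J n, (w n j d = root n ↔ d = 1)
  w_inj : ∀ n j j', (∀ d ∈ J n, w n j d = w n j' d) → j = j'

namespace TileSystem

variable {G : Type u} [Group G] (S : TileSystem G)

instance (n : ℕ) : Fintype (S.L n) := S.fin n

/-- `x` has a tile of level `n` with label `j` rooted at `g`. -/
def Tile : ∀ n, (G → Fin S.alph) → G → S.L n → Prop
  | 0, x, g, j => ∀ f ∈ S.F 0, x (g * f) = S.enc j f
  | n + 1, x, g, j => ∀ d ∈ S.J n, Tile n x (g * d) (S.w n j d)

theorem one_mem_F (n : ℕ) : 1 ∈ S.F n := by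
  induction n with
  | zero => exact S.one_mem_F_zero
  | succ n ih => simpa using S.mul_mem n 1 (S.one_mem_J n) 1 ih

theorem F_subset_succ (n : ℕ) : S.F n ⊆ S.F (n + 1) := fun f hf => by
  simpa using S.mul_mem n 1 (S.one_mem_J n) f hf

theorem F_mono : Monotone S.F := monotone_nat_of_le_succ S.F_subset_succ

theorem J_subset (n : ℕ) : S.J n ⊆ S.F (n + 1) := fun d hd => by
  simpa using S.mul_mem n d hd 1 (S.one_mem_F n)

theorem w_one (n : ℕ) (j : S.L (n + 1)) : S.w n j 1 = S.root n :=
  (S.w_root n j 1 (S.one_mem_J n)).2 rfl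

theorem exists_finset_subset (E : Finset G) (n₀ : ℕ) : ∃ n ≥ n₀, E ⊆ S.F n := by
  classical
  induction E using Finset.induction_on with
  | empty => exact ⟨n₀, le_rfl, by simp⟩
  | insert a E _ ih =>
    obtain ⟨n, hn, hE⟩ := ih
    obtain ⟨m, hm⟩ := S.exhaust a
    refine ⟨max n m, le_max_of_le_left hn, Finset.insert_subset ?_ ?_⟩
    · exact S.F_mono (le_max_right _ _) hm
    · exact hE.trans (S.F_mono (le_max_left _ _))

theorem tile_shift (n : ℕ) (h : G) (x : G → Fin S.alph) (g : G) (j : S.L n) :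
    S.Tile n (shift h x) g j ↔ S.Tile n x (h⁻¹ * g) j := by
  induction n generalizing g with
  | zero => simp [Tile, shift, mul_assoc]
  | succ n ih => simp [Tile, ih, mul_assoc]

theorem Tile.label_unique {S : TileSystem G} {n : ℕ} {x : G → Fin S.alph} {g : G} {j j' : S.L n}
    (h : S.Tile n x g j) (h' : S.Tile n x g j') : j = j' := by
  induction n generalizing g with
  | zero =>
    have h1 := S.one_mem_F_zero
    exact (S.enc_inj j j' 1 h1 1 h1 ((h 1 h1).symm.trans (h' 1 h1))).1
  | succ n ih => exact S.w_inj n j j' fun d hd => ih (h d hd) (h' d hd)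

theorem Tile.root {S : TileSystem G} {n : ℕ} {x : G → Fin S.alph} {g : G} {j : S.L (n + 1)}
    (h : S.Tile (n + 1) x g j) : S.Tile n x g (S.root n) := by
  simpa [S.w_one] using h 1 (S.one_mem_J n)

theorem Tile.eq_on {S : TileSystem G} {n : ℕ} {x y : G → Fin S.alph} {g g' : G} {j : S.L n}
    (h : S.Tile n x g j) (h' : S.Tile n y g' j) : ∀ f ∈ S.F n, x (g * f) = y (g' * f) := by
  induction n generalizing g g' with
  | zero => exact fun f hf => (h f hf).trans (h' f hf).symm
  | succ n ih =>
    intro f hf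
    obtain ⟨d, hd, hdf⟩ := S.exists_mul n f hf
    simpa [mul_assoc] using ih (h d hd) (h' d hd) _ hdf

theorem tile_congr {n : ℕ} {x y : G → Fin S.alph} {g g' : G} {j : S.L n}
    (h : S.Tile n x g j) (hxy : ∀ f ∈ S.F n, x (g * f) = y (g' * f)) : S.Tile n y g' j := by
  induction n generalizing g g' with
  | zero => exact fun f hf => (hxy f hf).symm.trans (h f hf)
  | succ n ih =>
    intro d hd
    refine ih (h d hd) fun f hf => ?_
    simpa [mul_assoc] using hxy _ (S.mul_mem n d hd f hf)

theorem isClopen_tile (n : ℕ) (g : G) (j : S.L n) : IsClopen {x | S.Tile n x g j} := by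
  induction n generalizing g with
  | zero =>
    have : {x | S.Tile 0 x g j} = ⋂ f ∈ S.F 0, (fun x : G → Fin S.alph => x (g * f)) ⁻¹' {S.enc j f} := by
      ext x; simp [Tile]
    rw [this]
    exact isClopen_biInter_finset fun f _ => (isClopen_discrete _).preimage (continuous_apply _)
  | succ n ih =>
    have : {x | S.Tile (n + 1) x g j} = ⋂ d ∈ S.J n, {x | S.Tile n x (g * d) (S.w n j d)} := by
      ext x; simp [Tile]
    rw [this]
    exact isClopen_biInter_finset fun d _ => ih _ _

/-- Concatenation: each position uses the configuration chosen for the subtile that contains it, and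
disjointness of the subtiles makes this consistent. -/
theorem exists_tile (n : ℕ) (j : S.L n) : ∃ x, S.Tile n x 1 j := by
  induction n with
  | zero => exact ⟨fun g => S.enc j g, fun f _ => by simp⟩
  | succ n ih =>
    choose B hB using ih
    choose! d hd hdF using S.exists_mul n
    refine ⟨fun g => B (S.w n j (d g)) ((d g)⁻¹ * g), fun e he => ?_⟩
    refine S.tile_congr (hB (S.w n j e)) fun f hf => ?_
    have h1 := S.mul_mem n e he f hf
    have : d (e * f) = e :=
      S.mul_inj n _ (hd _ h1) e he (e * f) (hdF _ h1) (by simpa using hf)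
    simp [this]

/-- The cylinders are nested because the identity subtile of any tile is a root tile at the same
place; compactness gives a common point. -/
theorem exists_tile_root : ∃ x, ∀ n, S.Tile n x 1 (S.root n) := by
  have := IsCompact.nonempty_iInter_of_sequence_nonempty_isCompact_isClosed
    (fun n => {x | S.Tile n x 1 (S.root n)}) (fun n x hx => Tile.root hx)
    (fun n => S.exists_tile n _) (S.isClopen_tile 0 1 _).isClosed.isCompact
    (fun n => (S.isClopen_tile n 1 _).isClosed)
  obtain ⟨x, hx⟩ := this
  exact ⟨x, fun n => by simpa using Set.mem_iInter.1 hx n⟩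

/-! ### Recognizability and minimality of the orbit closure. -/

/-- A configuration whose tiles at the identity are all root tiles. -/
noncomputable def base : G → Fin S.alph := S.exists_tile_root.choose

theorem tile_base (n : ℕ) : S.Tile n S.base 1 (S.root n) := S.exists_tile_root.choose_spec n

/-- The positions of the subtiles of level `n` in the tile of level `N`. -/
theorem exists_subtiles {n N : ℕ} (hnN : n ≤ N) : ∃ D : Set G,
    (∀ e ∈ D, ∀ f ∈ S.F n, e * f ∈ S.F N) ∧ (∀ h ∈ S.F N, ∃ e ∈ D, e⁻¹ * h ∈ S.F n) ∧
    (∀ e ∈ D, ∀ e' ∈ D, ∀ h, e⁻¹ * h ∈ S.F n → e'⁻¹ * h ∈ S.F n → e = e') ∧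
    ∀ x g j, S.Tile N x g j → ∀ e ∈ D, ∃ i, S.Tile n x (g * e) i := by
  induction N, hnN using Nat.le_induction with
  | base =>
    refine ⟨{1}, by simp, by simp, by simp, fun x g j h e he => ⟨j, ?_⟩⟩
    rw [Set.mem_singleton_iff.1 he, mul_one]; exact h
  | succ N hN ih =>
    obtain ⟨D, h1, h2, h3, h4⟩ := ih
    refine ⟨{e | ∃ d ∈ S.J N, ∃ c ∈ D, e = d * c}, ?_, ?_, ?_, ?_⟩
    · rintro _ ⟨d, hd, c, hc, rfl⟩ f hf
      rw [mul_assoc]; exact S.mul_mem N d hd _ (h1 c hc f hf)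
    · intro h hh
      obtain ⟨d, hd, hdh⟩ := S.exists_mul N h hh
      obtain ⟨c, hc, hch⟩ := h2 _ hdh
      exact ⟨d * c, ⟨d, hd, c, hc, rfl⟩, by simpa [mul_assoc] using hch⟩
    · rintro _ ⟨d, hd, c, hc, rfl⟩ _ ⟨d', hd', c', hc', rfl⟩ h hh hh'
      have e1 : d⁻¹ * h ∈ S.F N := by simpa [mul_assoc] using h1 c hc _ hh
      have e2 : d'⁻¹ * h ∈ S.F N := by simpa [mul_assoc] using h1 c' hc' _ hh'
      obtain rfl := S.mul_inj N d hd d' hd' h e1 e2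
      rw [h3 c hc c' hc' (d⁻¹ * h) (by simpa [mul_assoc] using hh) (by simpa [mul_assoc] using hh')]
    · rintro x g j hj _ ⟨d, hd, c, hc, rfl⟩
      simpa [mul_assoc] using h4 x _ _ (hj d hd) c hc

theorem Tile.exists_subtile {S : TileSystem G} {n N : ℕ} (hnN : n ≤ N) {x : G → Fin S.alph} {g : G}
    {j : S.L N} (h : S.Tile N x g j) {a : G} (ha : g⁻¹ * a ∈ S.F N) :
    ∃ c i, S.Tile n x c i ∧ c⁻¹ * a ∈ S.F n ∧ ∀ f ∈ S.F n, g⁻¹ * (c * f) ∈ S.F N := by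
  obtain ⟨D, h1, h2, -, h4⟩ := S.exists_subtiles hnN
  obtain ⟨e, he, hea⟩ := h2 _ ha
  obtain ⟨i, hi⟩ := h4 x g j h e he
  exact ⟨g * e, i, hi, by simpa [mul_assoc] using hea, fun f hf => by
    simpa [mul_assoc] using h1 e he f hf⟩

/-- At level 0 a letter encodes both the label and the position in the tile. At level `n + 1`, both
base points lie in a large root tile cut into its standard subtiles. By induction, the root subtile
of level `n` at `c` is a subtile of a standard tile; its root label puts it at the base point of
that tile. So `c` and `c'` are standard positions, whose tiles are disjoint. -/
theorem tile_base_unique {n : ℕ} {c c' a : G} {j j' : S.L n} (h : S.Tile n S.base c j)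
    (h' : S.Tile n S.base c' j') (ha : c⁻¹ * a ∈ S.F n) (ha' : c'⁻¹ * a ∈ S.F n) : c = c' := by
  induction n generalizing c c' a with
  | zero =>
    have e1 := h _ ha
    have e2 := h' _ ha'
    simp only [mul_inv_cancel_left] at e1 e2
    have := (S.enc_inj _ _ _ ha _ ha' (e1.symm.trans e2)).2
    simpa using this
  | succ n ih =>
    classical
    obtain ⟨N, hN, hsub⟩ := S.exists_finset_subset {c, c'} (n + 1)
    obtain ⟨D, h1, h2, h3, h4⟩ := S.exists_subtiles hN
    have key : ∀ c j, c ∈ S.F N → S.Tile (n + 1) S.base c j → c ∈ D := by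
      intro c j hc hj
      obtain ⟨e, he, hec⟩ := h2 c hc
      obtain ⟨i, hi⟩ := h4 _ _ _ (S.tile_base N) e he
      rw [one_mul] at hi
      obtain ⟨d, hd, hdc⟩ := S.exists_mul n _ hec
      have hce : c = e * d := ih (a := c) hj.root (hi d hd) (by simpa using S.one_mem_F n)
        (by simpa [mul_assoc] using hdc)
      have := hi d hd
      rw [← hce] at this
      have := (S.w_root n i d hd).1 (this.label_unique hj.root)
      rw [hce, this, mul_one]; exact he
    exact h3 c (key c j (hsub (by simp)) h) c' (key c' j' (hsub (by simp)) h') a ha ha'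

/-- The orbit closure of the base configuration. -/
noncomputable def subshift : Subshift G S.alph where
  carrier := closure (Set.range fun g => shift g S.base)
  isClosed := isClosed_closure
  shift_mem g x hx := by
    have hc : Continuous (shift g : (G → Fin S.alph) → _) :=
      continuous_pi fun h => continuous_apply _
    refine map_mem_closure hc hx ?_
    rintro _ ⟨h, rfl⟩
    exact ⟨g * h, by ext a; simp [shift, mul_assoc]⟩

theorem base_mem : S.base ∈ S.subshift.carrier :=
  subset_closure ⟨1, by ext; simp [shift]⟩

theorem subshift_induction {P : (G → Fin S.alph) → Prop} (hP : IsClosed {x | P x})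
    (h : ∀ g, P (shift g S.base)) : ∀ x ∈ S.subshift.carrier, P x := fun x hx =>
  closure_minimal (s := Set.range fun g => shift g S.base) (t := {x | P x})
    (by rintro _ ⟨g, rfl⟩; exact h g) hP hx

/-- For fixed positions and labels, coexistence of the two tiles is a clopen condition, so it
suffices to exclude it on the orbit of `base`. -/
theorem tile_unique {n : ℕ} {x : G → Fin S.alph} (hx : x ∈ S.subshift.carrier) {c c' a : G}
    {j j' : S.L n} (h : S.Tile n x c j) (h' : S.Tile n x c' j')
    (ha : c⁻¹ * a ∈ S.F n) (ha' : c'⁻¹ * a ∈ S.F n) : c = c' := by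
  by_contra hne
  refine S.subshift_induction (P := fun x => ¬ (S.Tile n x c j ∧ S.Tile n x c' j')) ?_ ?_ x hx ⟨h, h'⟩
  · exact ((S.isClopen_tile n c j).inter (S.isClopen_tile n c' j')).compl.isClosed
  · rintro g ⟨h1, h2⟩
    rw [tile_shift] at h1 h2
    have := S.tile_base_unique (a := g⁻¹ * a) h1 h2 (by simpa [mul_assoc] using ha)
      (by simpa [mul_assoc] using ha')
    exact hne (by simpa using this)

/-- Being covered is a closed condition since positions and labels are finite in number; on the
orbit of `base` it holds because the root tiles at the identity exhaust the group. -/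
theorem exists_tile_mem {x : G → Fin S.alph} (hx : x ∈ S.subshift.carrier) (n : ℕ) (a : G) :
    ∃ f ∈ S.F n, ∃ j, S.Tile n x (a * f⁻¹) j := by
  refine S.subshift_induction (P := fun x => ∃ f ∈ S.F n, ∃ j, S.Tile n x (a * f⁻¹) j) ?_ ?_ x hx
  · have : {x | ∃ f ∈ S.F n, ∃ j, S.Tile n x (a * f⁻¹) j} =
        ⋃ f ∈ S.F n, ⋃ j, {x | S.Tile n x (a * f⁻¹) j} := by ext; simp
    rw [this]
    exact (S.F n).finite_toSet.isClosed_biUnion fun f _ =>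
      isClosed_iUnion_of_finite fun j => (S.isClopen_tile n _ j).isClosed
  · intro g
    obtain ⟨N, hN, hsub⟩ := S.exists_finset_subset {g⁻¹ * a} n
    obtain ⟨c, i, hi, hc, -⟩ := (S.tile_base N).exists_subtile hN (a := g⁻¹ * a)
      (by simpa using hsub)
    refine ⟨c⁻¹ * (g⁻¹ * a), hc, i, ?_⟩
    rw [tile_shift]
    simpa [mul_assoc] using hi

/-- A tile of lower level which meets a tile of higher level lies in it. -/
theorem tile_nested {m n : ℕ} (hmn : m ≤ n) {x : G → Fin S.alph} (hx : x ∈ S.subshift.carrier)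
    {c e a : G} {i : S.L m} {j : S.L n} (hi : S.Tile m x c i) (hj : S.Tile n x e j)
    (hc : c⁻¹ * a ∈ S.F m) (he : e⁻¹ * a ∈ S.F n) : ∀ f ∈ S.F m, e⁻¹ * (c * f) ∈ S.F n := by
  obtain ⟨c', i', hi', hc', hsub⟩ := hj.exists_subtile hmn he
  rw [S.tile_unique hx hi hi' hc hc']
  exact hsub

theorem mem_closure_of_eq_on {s : Set (G → Fin S.alph)} {x : G → Fin S.alph}
    (h : ∀ n, ∃ y ∈ s, ∀ f ∈ S.F n, y f = x f) : x ∈ closure s := by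
  choose y hys hy using h
  refine mem_closure_of_tendsto (f := y) (b := atTop) ?_ (Eventually.of_forall hys)
  rw [tendsto_pi_nhds]
  intro g
  obtain ⟨n, hn⟩ := S.exhaust g
  refine tendsto_const_nhds.congr' ?_
  filter_upwards [eventually_ge_atTop n] with m hm
  exact (hy m g (S.F_mono hm hn)).symm

theorem isMinimal_subshift : S.subshift.IsMinimal := by
  refine ⟨⟨_, S.base_mem⟩, fun x => ?_⟩
  rw [Subtype.dense_iff]
  have hc : ∀ g, Continuous (shift g : (G → Fin S.alph) → _) := fun g =>
    continuous_pi fun h => continuous_apply _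
  have himg : ((↑) '' (Set.range fun g : G => S.subshift.shiftMap g x)) =
      Set.range fun g => shift g x.1 := by
    rw [← Set.range_comp]; rfl
  rw [himg]
  have hbase : S.base ∈ closure (Set.range fun g => shift g x.1) := by
    refine S.mem_closure_of_eq_on fun n => ?_
    -- Level `n + 1` is needed: a tile of level `n` may have any label, but the identity subtile of
    -- a tile of level `n + 1` shows the pattern of `base` on `F n`.
    obtain ⟨f, -, j, hj⟩ := S.exists_tile_mem x.2 (n + 1) 1
    refine ⟨_, ⟨(1 * f⁻¹)⁻¹, rfl⟩, fun a ha => ?_⟩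
    simpa [shift] using hj.root.eq_on (S.tile_base n) a ha
  refine closure_minimal ?_ isClosed_closure
  rintro _ ⟨g, rfl⟩
  refine map_mem_closure (hc g) hbase ?_
  rintro _ ⟨h, rfl⟩
  exact ⟨g * h, by ext a; simp [shift, mul_assoc]⟩

/-- The shift carries the tile at `c` to a tile at `g c`; both contain `g a`, so `g c = c`. -/
theorem shift_eq_of_same_tile {n : ℕ} {x : G → Fin S.alph} (hx : x ∈ S.subshift.carrier) {g a c : G}
    {j : S.L n} (hj : S.Tile n x c j) (ha : c⁻¹ * a ∈ S.F n) (hga : c⁻¹ * (g * a) ∈ S.F n)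
    (hg : shift g x = x) : g = 1 := by
  have h1 : S.Tile n x (g * c) j := by
    have := S.tile_shift n g x (g * c) j
    rw [hg] at this
    exact this.2 (by simpa using hj)
  have := S.tile_unique hx hj h1 hga (by simpa [mul_assoc] using ha)
  simpa using this.symm

end TileSystem

namespace TileSystem

variable {G : Type u} [Group G] (S : TileSystem G)

/-! ### Stabilizers -/

/-- The subtile at `d` of the tile of level `n + 1` is far from the boundary, with respect to the
set `E` of directions. -/
def Interior (n : ℕ) (E : Set G) (d : G) : Prop :=
  ∀ f ∈ S.F n, ∀ a ∈ E, d * f * a ∈ S.F (n + 1)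

/-- A colouring of the labels by a group: a subtile inherits the colour of its parent near the
boundary, and forgets it in the interior. -/
def ColorLaw (Γ : Subgroup G) [Γ.Normal] (E : ℕ → Set G) (col : ∀ n, S.L n → G ⧸ Γ) : Prop :=
  ∀ n j, ∀ d ∈ S.J n, (S.Interior n (E n) d → col n (S.w n j d) = (d : G ⧸ Γ)) ∧
    (¬ S.Interior n (E n) d → col n (S.w n j d) = col (n + 1) j * (d : G ⧸ Γ))

theorem Interior.mono {S : TileSystem G} {n : ℕ} {E E' : Set G} (h : E ⊆ E') {d : G}
    (hd : S.Interior n E' d) : S.Interior n E d := fun f hf a ha => hd f hf a (h ha)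

theorem exists_parent {n : ℕ} {x : G → Fin S.alph} (hx : x ∈ S.subshift.carrier) {c a : G}
    {i : S.L n} (hi : S.Tile n x c i) (ha : c⁻¹ * a ∈ S.F n) :
    ∃ e j, ∃ d ∈ S.J n, S.Tile (n + 1) x e j ∧ e⁻¹ * a ∈ S.F (n + 1) ∧ c = e * d ∧ i = S.w n j d := by
  obtain ⟨f, hf, j, hj⟩ := S.exists_tile_mem hx (n + 1) a
  obtain ⟨d, hd, hdf⟩ := S.exists_mul n f hf
  have h1 : (a * f⁻¹)⁻¹ * a = f := by group
  have hcd : c = a * f⁻¹ * d := S.tile_unique hx hi (hj d hd) ha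
    (by rw [mul_inv_rev, mul_assoc, h1]; exact hdf)
  refine ⟨a * f⁻¹, j, d, hd, hj, by rwa [h1], hcd, ?_⟩
  rw [hcd] at hi
  exact hi.label_unique (hj d hd)

section Colors

variable {S} {Γ : Subgroup G} [Γ.Normal] {E : ℕ → Set G} {col : ∀ n, S.L n → G ⧸ Γ}

/-- Both colours are the positions, or both are the colour of the common parent times the positions;
the positions cancel and only the cosets of `c` and `c'` remain. -/
theorem ColorLaw.eq_of_iff (h : S.ColorLaw Γ E col) {n : ℕ} {j : S.L (n + 1)} {d d' e c c' : G}
    (hd : d ∈ S.J n) (hd' : d' ∈ S.J n)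
    (hdd : S.Interior n (E n) d ↔ S.Interior n (E n) d')
    (heq : col n (S.w n j d) * (((e * d)⁻¹ * c : G) : G ⧸ Γ) =
      col n (S.w n j d') * (((e * d')⁻¹ * c' : G) : G ⧸ Γ)) : (c : G ⧸ Γ) = c' := by
  by_cases hi : S.Interior n (E n) d
  · rw [(h n j d hd).1 hi, (h n j d' hd').1 (hdd.1 hi)] at heq
    simpa [mul_assoc] using heq
  · rw [(h n j d hd).2 hi, (h n j d' hd').2 (mt hdd.2 hi)] at heq
    simpa [mul_assoc] using heq

/-- The colour times the relative position of `c` passes unchanged to the parent near the boundary.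
This is the invariant followed in `color_base`. -/
theorem ColorLaw.step (h : S.ColorLaw Γ E col) {n : ℕ} {j : S.L (n + 1)} {d e c : G}
    (hd : d ∈ S.J n) (hi : ¬ S.Interior n (E n) d) :
    col n (S.w n j d) * (((e * d)⁻¹ * c : G) : G ⧸ Γ) =
      col (n + 1) j * ((e⁻¹ * c : G) : G ⧸ Γ) := by
  rw [(h n j d hd).2 hi]
  simp [mul_assoc]

end Colors

section

variable (Γ : Subgroup G) [Γ.Normal] {E E' : ℕ → Set G} {col col' : ∀ n, S.L n → G ⧸ Γ}

/-- Follow the ancestors of the two tiles upwards, around `b` and `b * g`. As long as the parents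
differ, both subtiles are close to the boundary of their parents, and the equality of the invariants
persists for both colours. The ancestors merge at last, in a root tile at the identity. When they
merge, `eq_of_iff` concludes with the first colour unless exactly one subtile is `E`-interior; in
that case neither is `E'`-interior, and the second colour concludes. Hence the need for two colours.
-/
theorem color_base (h : S.ColorLaw Γ E col) (h' : S.ColorLaw Γ E' col')
    (hEE : ∀ n, E n * (S.F n : Set G)⁻¹ * (S.F n : Set G) * E n ⊆ E' n) (hE1 : ∀ n, 1 ∈ E n)
    {n : ℕ} {g : G} (hg : ∀ m ≥ n, g ∈ E m ∧ g⁻¹ ∈ E m) {b c c' : G} {i : S.L n}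
    (hc : S.Tile n S.base c i) (hc' : S.Tile n S.base c' i) (hb : c⁻¹ * b ∈ S.F n)
    (hb' : c'⁻¹ * (b * g) ∈ S.F n) : (c : G ⧸ Γ) = c' := by
  by_contra hne
  have hEsub : ∀ m, E m ⊆ E' m := fun m a ha => hEE m
    ⟨1, ⟨1, ⟨1, hE1 m, 1, by simpa using S.one_mem_F m, by simp⟩, 1, S.one_mem_F m, by simp⟩,
      a, ha, by simp⟩
  have key : ∀ N ≥ n, ∃ e e' : G, ∃ j j' : S.L N, S.Tile N S.base e j ∧ S.Tile N S.base e' j' ∧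
      e⁻¹ * b ∈ S.F N ∧ e'⁻¹ * (b * g) ∈ S.F N ∧ e ≠ e' ∧
      col N j * ((e⁻¹ * c : G) : G ⧸ Γ) = col N j' * ((e'⁻¹ * c' : G) : G ⧸ Γ) ∧
      col' N j * ((e⁻¹ * c : G) : G ⧸ Γ) = col' N j' * ((e'⁻¹ * c' : G) : G ⧸ Γ) := by
    intro N hN
    induction N, hN using Nat.le_induction with
    | base => exact ⟨c, c', i, i, hc, hc', hb, hb', fun hcc => hne (by rw [hcc]), by simp, by simp⟩
    | succ N hN ih =>
      obtain ⟨a, a', k, k', ht, ht', hba, hba', -, hcol, hcol'⟩ := ih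
      obtain ⟨e, j, d, hd, hj, he, rfl, rfl⟩ := S.exists_parent S.base_mem ht hba
      obtain ⟨e', j', d', hd', hj', he', rfl, rfl⟩ := S.exists_parent S.base_mem ht' hba'
      by_cases hee : e = e'
      · exfalso
        subst hee
        obtain rfl := hj.label_unique hj'
        -- Going from `b₁` to `b₁ * g₁`, to the base point of the second subtile, to one of its
        -- points, then in a direction of `E`, uses `E`, `F⁻¹`, `F` and `E` in turn. This dictates
        -- the size of `E'`.
        have hbd : ∀ d₁ d₂ g₁ b₁, (e * d₁)⁻¹ * b₁ ∈ S.F N → (e * d₂)⁻¹ * (b₁ * g₁) ∈ S.F N →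
            g₁ ∈ E N → S.Interior N (E' N) d₁ → S.Interior N (E N) d₂ := by
          intro d₁ d₂ g₁ b₁ h1 h2 hg1 hint f hf u hu
          have := hint _ h1 (g₁ * ((e * d₂)⁻¹ * (b₁ * g₁))⁻¹ * f * u)
            (hEE N ⟨_, ⟨_, ⟨g₁, hg1, _, Set.inv_mem_inv.2 h2, rfl⟩, f, hf, rfl⟩, u, hu, rfl⟩)
          convert this using 1
          group
        by_cases hdd : S.Interior N (E N) d ↔ S.Interior N (E N) d'
        · exact hne (h.eq_of_iff hd hd' hdd hcol)
        · have key1 := hbd d d' g b hba hba' (hg N hN).1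
          have key2 := hbd d' d g⁻¹ (b * g) hba' (by simpa using hba) (hg N hN).2
          have m1 := Interior.mono (S := S) (n := N) (hEsub N) (d := d)
          have m2 := Interior.mono (S := S) (n := N) (hEsub N) (d := d')
          exact hne (h'.eq_of_iff hd hd' (by tauto) hcol')
      · have hd1 : ¬ S.Interior N (E N) d := fun hint => hee <| by
          have := hint _ hba g (hg N hN).1
          refine S.tile_unique S.base_mem hj hj' (a := b * g) ?_ he'
          convert this using 1; group
        have hd2 : ¬ S.Interior N (E N) d' := fun hint => hee <| by
          have := hint _ hba' g⁻¹ (hg N hN).2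
          refine S.tile_unique S.base_mem hj hj' (a := b) he ?_
          convert this using 1; group
        rw [h.step hd hd1, h.step hd' hd2] at hcol
        rw [h'.step hd (mt (Interior.mono (hEsub N)) hd1),
          h'.step hd' (mt (Interior.mono (hEsub N)) hd2)] at hcol'
        exact ⟨e, e', j, j', hj, hj', he, he', hee, hcol, hcol'⟩
  classical
  obtain ⟨N, hN, hsub⟩ := S.exists_finset_subset {b, b * g} n
  obtain ⟨e, e', j, j', hj, hj', he, he', hee, -⟩ := key N hN
  refine hee ((S.tile_unique S.base_mem hj (S.tile_base N) he (hsub (by simp))).trans ?_)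
  exact (S.tile_unique S.base_mem hj' (S.tile_base N) he' (hsub (by simp))).symm

/-- A tile of `x` and its translate by `g` carry the same label, so `color_base` puts their base
points in the same coset, after transport to `base`. The set `F F⁻¹` contains `g` and `g⁻¹` from the
level on where `F` contains `g`. -/
theorem mem_of_shift_eq (h : S.ColorLaw Γ E col) (h' : S.ColorLaw Γ E' col')
    (hE : ∀ n, E n = (S.F n : Set G) * (S.F n : Set G)⁻¹)
    (hEE : ∀ n, E n * (S.F n : Set G)⁻¹ * (S.F n : Set G) * E n ⊆ E' n)
    {x : G → Fin S.alph} (hx : x ∈ S.subshift.carrier) {g : G} (hg : shift g x = x) : g ∈ Γ := by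
  by_contra hne
  obtain ⟨n, hn⟩ := S.exhaust g
  obtain ⟨f, hf, j, hj⟩ := S.exists_tile_mem hx n 1
  have hj' : S.Tile n x (g * (1 * f⁻¹)) j := by
    have := S.tile_shift n g x (g * (1 * f⁻¹)) j
    rw [hg] at this
    exact this.2 (by simpa using hj)
  refine S.subshift_induction
    (P := fun x => ¬ (S.Tile n x (1 * f⁻¹) j ∧ S.Tile n x (g * (1 * f⁻¹)) j)) ?_ ?_ x hx ⟨hj, hj'⟩
  · exact ((S.isClopen_tile n _ j).inter (S.isClopen_tile n _ j)).compl.isClosed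
  · rintro a ⟨h1, h2⟩
    rw [tile_shift] at h1 h2
    have := S.color_base Γ h h' hEE (b := a⁻¹) (g := g) ?_ ?_ h1 h2 ?_ ?_
    · apply hne
      simpa [mul_assoc] using this
    · intro m; rw [hE]
      exact ⟨1, S.one_mem_F m, 1, by simpa using S.one_mem_F m, by simp⟩
    · intro m hm
      rw [hE]
      have := S.F_mono hm hn
      exact ⟨⟨g, this, 1, by simpa using S.one_mem_F m, by simp⟩,
        ⟨1, S.one_mem_F m, g⁻¹, by simpa using this, by simp⟩⟩
    · simpa [mul_assoc] using hf
    · simpa [mul_assoc] using hf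

end

/-- Once `F n` contains all conjugates of `g`, a tile of level `n` contains the image by `g` of its
own base point. -/
theorem eq_one_of_finite_conj {x : G → Fin S.alph} (hx : x ∈ S.subshift.carrier) {g : G}
    (hfin : (Set.range fun c : G => c * g * c⁻¹).Finite) (hg : shift g x = x) : g = 1 := by
  obtain ⟨n, -, hn⟩ := S.exists_finset_subset hfin.toFinset 0
  obtain ⟨f, hf, j, hj⟩ := S.exists_tile_mem hx n 1
  refine S.shift_eq_of_same_tile hx (a := 1 * f⁻¹) hj (by simpa using S.one_mem_F n) ?_ hg
  exact hn (by simp [mul_assoc])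

theorem finite_conj_of_commute {Γ : Subgroup G} [Γ.FiniteIndex]
    {g : G} (h : ∀ a ∈ Γ, a * g = g * a) : (Set.range fun c : G => c * g * c⁻¹).Finite := by
  refine (Set.finite_range fun q : G ⧸ Γ => q.out * g * q.out⁻¹).subset ?_
  rintro _ ⟨c, rfl⟩
  refine ⟨(c : G ⧸ Γ), ?_⟩
  obtain ⟨γ, hγ⟩ := QuotientGroup.mk_out_eq_mul Γ c
  simp only [hγ]
  have := h γ γ.2
  calc c * γ * g * (c * γ)⁻¹ = c * (γ * g) * (γ : G)⁻¹ * c⁻¹ := by group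
    _ = c * g * c⁻¹ := by rw [this]; group

/-! ### Invariant measures of tiles -/

/-- The points of the subshift with a tile of level `n` labelled `j` at `g`. -/
def cyl (n : ℕ) (g : G) (j : S.L n) : Set S.subshift.carrier := {x | S.Tile n x.1 g j}

theorem isClopen_cyl (n : ℕ) (g : G) (j : S.L n) : IsClopen (S.cyl n g j) :=
  (S.isClopen_tile n g j).preimage continuous_subtype_val

theorem measurableSet_cyl [Countable G] (n : ℕ) (g : G) (j : S.L n) : MeasurableSet (S.cyl n g j) :=
  (S.isClopen_cyl n g j).isOpen.measurableSet

theorem shiftMap_mul {m : ℕ} (X : Subshift G m) (g h : G) (x : X.carrier) :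
    X.shiftMap (g * h) x = X.shiftMap g (X.shiftMap h x) :=
  Subtype.ext (by ext a; simp [Subshift.shiftMap, shift, mul_assoc])

theorem shiftMap_one {m : ℕ} (X : Subshift G m) (x : X.carrier) : X.shiftMap 1 x = x :=
  Subtype.ext (by ext a; simp [Subshift.shiftMap, shift])

theorem image_shiftMap {m : ℕ} (X : Subshift G m) (g : G) (s : Set X.carrier) :
    X.shiftMap g '' s = X.shiftMap g⁻¹ ⁻¹' s := by
  ext x
  constructor
  · rintro ⟨y, hy, rfl⟩
    simpa [← shiftMap_mul, shiftMap_one] using hy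
  · intro hx
    exact ⟨_, hx, by simp [← shiftMap_mul, shiftMap_one]⟩

theorem image_cyl (n : ℕ) (g h : G) (j : S.L n) :
    S.subshift.shiftMap g '' S.cyl n h j = S.cyl n (g * h) j := by
  rw [image_shiftMap]
  ext x
  simp [cyl, Subshift.shiftMap, tile_shift]

variable {μ : ProbabilityMeasure S.subshift.carrier}

/-- The measure of the cylinder of the points with a tile at the identity. -/
noncomputable def freq (μ : ProbabilityMeasure S.subshift.carrier) (n : ℕ) (j : S.L n) : ℝ :=
  (μ : Measure S.subshift.carrier).real (S.cyl n 1 j)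

theorem freq_nonneg (n : ℕ) (j : S.L n) : 0 ≤ S.freq μ n j := measureReal_nonneg

theorem measureReal_cyl [Countable G] (hμ : μ ∈ S.subshift.invariantMeasures) (n : ℕ) (g : G) (j : S.L n) :
    (μ : Measure S.subshift.carrier).real (S.cyl n g j) = S.freq μ n j := by
  have := hμ g _ (S.measurableSet_cyl n 1 j)
  rw [image_cyl, mul_one] at this
  simp [freq, measureReal_def, this]

/-- The space is partitioned according to the tile of level `n` that covers the identity. -/
theorem measureReal_eq_sum [Countable G] (μ : ProbabilityMeasure S.subshift.carrier) {A : Set S.subshift.carrier}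
    (hA : MeasurableSet A) (n : ℕ) :
    (μ : Measure S.subshift.carrier).real A =
      ∑ f ∈ S.F n, ∑ j, (μ : Measure S.subshift.carrier).real (A ∩ S.cyl n f⁻¹ j) := by
  classical
  rw [← Finset.sum_product', ← measureReal_biUnion_finset]
  · congr 1
    ext x
    simp only [Set.mem_iUnion, Set.mem_inter_iff, Finset.mem_product]
    refine ⟨fun hx => ?_, fun ⟨_, _, hx, _⟩ => hx⟩
    obtain ⟨f, hf, j, hj⟩ := S.exists_tile_mem x.2 n 1
    exact ⟨(f, j), by simpa using hf, hx, by simpa [cyl] using hj⟩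
  · rintro ⟨f, j⟩ hf ⟨f', j'⟩ hf' hne
    refine Set.disjoint_left.2 fun x hx hx' => hne ?_
    simp only [Finset.coe_product, Set.mem_prod, Finset.mem_coe] at hf hf'
    have h1 : S.Tile n x.1 f⁻¹ j := hx.2
    have h2 : S.Tile n x.1 f'⁻¹ j' := hx'.2
    have := inv_injective (S.tile_unique x.2 h1 h2 (a := 1) (by simpa using hf.1)
      (by simpa using hf'.1))
    subst this
    rw [h1.label_unique h2]
  · exact fun b _ => hA.inter (S.measurableSet_cyl _ _ _)

theorem card_mul_sum_freq [Countable G] (hμ : μ ∈ S.subshift.invariantMeasures) (n : ℕ) :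
    ((S.F n).card : ℝ) * ∑ j, S.freq μ n j = 1 := by
  have := S.measureReal_eq_sum μ MeasurableSet.univ n
  simp only [Set.univ_inter, S.measureReal_cyl hμ, Finset.sum_const, nsmul_eq_mul] at this
  rw [← this]
  simp

theorem exists_parent_one {n : ℕ} {x : G → Fin S.alph} (hx : x ∈ S.subshift.carrier) {i : S.L n}
    {g : G} (hi : S.Tile n x g i) :
    ∃ j, ∃ d ∈ S.J n, S.Tile (n + 1) x (g * d⁻¹) j ∧ S.w n j d = i := by
  obtain ⟨e, j, d, hd, hj, -, rfl, rfl⟩ := S.exists_parent hx hi (a := g)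
    (by simpa using S.one_mem_F n)
  exact ⟨j, d, hd, by simpa using hj, rfl⟩

/-- Two parents of the same tile coincide. -/
theorem parent_unique {n : ℕ} {x : G → Fin S.alph} (hx : x ∈ S.subshift.carrier) {g d d' : G}
    {j j' : S.L (n + 1)} (hd : d ∈ S.J n) (hd' : d' ∈ S.J n)
    (hj : S.Tile (n + 1) x (g * d⁻¹) j) (hj' : S.Tile (n + 1) x (g * d'⁻¹) j') :
    d = d' ∧ j = j' := by
  have := S.tile_unique hx hj hj' (a := g) (by simpa [mul_assoc] using S.J_subset n hd)
    (by simpa [mul_assoc] using S.J_subset n hd')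
  have : d = d' := by simpa using this
  subst this
  exact ⟨rfl, hj.label_unique hj'⟩

open scoped Classical in
/-- The number of subtiles labelled `i` in a tile labelled `j`. -/
noncomputable def count (n : ℕ) (i : S.L n) (j : S.L (n + 1)) : ℕ :=
  ((S.J n).filter fun d => S.w n j d = i).card

/-- The cylinder is partitioned by the parent of the tile at the identity, and invariance removes
the dependence on the position in the parent. -/
theorem freq_step [Countable G] (hμ : μ ∈ S.subshift.invariantMeasures) (n : ℕ) (i : S.L n) :
    S.freq μ n i = ∑ j, (S.count n i j : ℝ) * S.freq μ (n + 1) j := by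
  classical
  have hU : S.cyl n 1 i = ⋃ p ∈ (Finset.univ.sigma fun j => (S.J n).filter fun d => S.w n j d = i),
      S.cyl (n + 1) p.2⁻¹ p.1 := by
    ext x
    simp only [Set.mem_iUnion, Finset.mem_sigma, Finset.mem_univ, true_and, Finset.mem_filter]
    constructor
    · intro hx
      obtain ⟨j, d, hd, hj, hw⟩ := S.exists_parent_one x.2 hx
      exact ⟨⟨j, d⟩, ⟨hd, hw⟩, by simpa [cyl] using hj⟩
    · rintro ⟨⟨j, d⟩, ⟨hd, rfl⟩, hj⟩
      simpa [cyl] using (show S.Tile (n + 1) x.1 d⁻¹ j from hj) d hd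
  rw [freq, hU, measureReal_biUnion_finset, Finset.sum_sigma]
  · refine Finset.sum_congr rfl fun j _ => ?_
    rw [Finset.sum_congr rfl fun d _ => S.measureReal_cyl hμ (n + 1) d⁻¹ j]
    simp [count]
  · rintro ⟨j, d⟩ hp ⟨j', d'⟩ hp' hne
    refine Set.disjoint_left.2 fun x hx hx' => hne ?_
    simp only [Finset.coe_sigma, Set.mem_sigma_iff, Finset.mem_coe, Finset.mem_filter] at hp hp'
    obtain ⟨rfl, rfl⟩ := S.parent_unique x.2 (g := 1) hp.2.1 hp'.2.1
      (by simpa [cyl] using hx) (by simpa [cyl] using hx')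
    rfl
  · exact fun _ _ => S.measurableSet_cyl _ _ _

theorem sum_count (n : ℕ) (j : S.L (n + 1)) : ∑ i, S.count n i j = (S.J n).card := by
  classical
  exact (Finset.card_eq_sum_card_fiberwise (f := fun d => S.w n j d) (t := Finset.univ)
    (by simp)).symm

open scoped Classical in
theorem card_J_mul (n : ℕ) : (S.J n).card * (S.F n).card = (S.F (n + 1)).card := by
  rw [← Finset.card_product]
  refine Finset.card_nbij (fun p => p.1 * p.2) ?_ ?_ ?_
  · rintro ⟨d, f⟩ h
    simp only [Finset.coe_product, Set.mem_prod, Finset.mem_coe] at h ⊢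
    exact S.mul_mem n d h.1 f h.2
  · rintro ⟨d, f⟩ h ⟨d', f'⟩ h' heq
    simp only [Finset.coe_product, Set.mem_prod, Finset.mem_coe] at h h' heq
    obtain rfl := S.mul_inj n d h.1 d' h'.1 (d * f) (by simpa using h.2) (by simpa [heq] using h'.2)
    simpa using heq
  · intro h hh
    obtain ⟨d, hd, hdh⟩ := S.exists_mul n h hh
    exact ⟨(d, d⁻¹ * h), by simp [hd, hdh], by simp⟩

end TileSystem

/-! ### Inverse limits of simplices and approximate solutions -/

section InverseLimit

/-- The `ℓ¹` norm of a vector. -/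
def l1 {ι : Type*} [Fintype ι] (v : ι → ℝ) : ℝ := ∑ i, |v i|

section l1

variable {ι : Type*} [Fintype ι]

theorem l1_nonneg (v : ι → ℝ) : 0 ≤ l1 v := Finset.sum_nonneg fun _ _ => abs_nonneg _

theorem l1_sub_le (a b c : ι → ℝ) : l1 (a - c) ≤ l1 (a - b) + l1 (b - c) := by
  rw [l1, l1, l1, ← Finset.sum_add_distrib]
  exact Finset.sum_le_sum fun i _ => abs_sub_le _ _ _

theorem l1_sub_comm (a b : ι → ℝ) : l1 (a - b) = l1 (b - a) :=
  Finset.sum_congr rfl fun _ _ => abs_sub_comm _ _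

theorem abs_apply_le_l1 (v : ι → ℝ) (i : ι) : |v i| ≤ l1 v :=
  Finset.single_le_sum (f := fun i => |v i|) (fun _ _ => abs_nonneg _) (Finset.mem_univ i)

theorem norm_le_l1 (v : ι → ℝ) : ‖v‖ ≤ l1 v :=
  (pi_norm_le_iff_of_nonneg (l1_nonneg v)).2 fun i => abs_apply_le_l1 v i

theorem continuous_l1 : Continuous (l1 : (ι → ℝ) → ℝ) :=
  continuous_finsetSum _ fun i _ => (continuous_apply i).abs

theorem eq_of_l1_le_zero {a b : ι → ℝ} (h : l1 (a - b) ≤ 0) : a = b := by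
  funext i
  have := (abs_apply_le_l1 (a - b) i).trans h
  simpa [sub_eq_zero] using this

theorem l1_add_le (a b : ι → ℝ) : l1 (a + b) ≤ l1 a + l1 b := by
  rw [l1, l1, l1, ← Finset.sum_add_distrib]
  exact Finset.sum_le_sum fun i _ => abs_add_le _ _

theorem l1_smul (t : ℝ) (a : ι → ℝ) : l1 (t • a) = |t| * l1 a := by
  simp [l1, Finset.mul_sum, abs_mul]

end l1

variable {k : ℕ → ℕ} (M : ∀ n, Matrix (Fin (k n)) (Fin (k (n + 1))) ℕ)

/-- The image of a vector of level `j` in the levels `i ≤ j`. -/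
noncomputable def push : ∀ j, (Fin (k j) → ℝ) → ∀ i, Fin (k i) → ℝ
  | 0, v => Function.update 0 0 v
  | j + 1, v => Function.update (push j (((M j).map (Nat.cast : ℕ → ℝ)).mulVec v)) (j + 1) v

theorem push_self (j : ℕ) (v : Fin (k j) → ℝ) : push M j v j = v := by
  cases j <;> simp [push]

theorem push_succ {i j : ℕ} (h : i ≤ j) (v : Fin (k (j + 1)) → ℝ) :
    push M (j + 1) v i = push M j (((M j).map (Nat.cast : ℕ → ℝ)).mulVec v) i := by
  simp [push, Function.update_of_ne (show i ≠ j + 1 by omega)]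

theorem push_eq_mulVec {i j : ℕ} (h : i < j) (v : Fin (k j) → ℝ) :
    push M j v i = ((M i).map (Nat.cast : ℕ → ℝ)).mulVec (push M j v (i + 1)) := by
  induction j, h using Nat.le_induction with
  | base => rw [push_succ M le_rfl, push_self, push_self]
  | succ j hj ih => rw [push_succ M (by omega), push_succ M hj, ih]

theorem push_push {i j l : ℕ} (hij : i ≤ j) (hjl : j ≤ l) (v : Fin (k l) → ℝ) :
    push M j (push M l v j) i = push M l v i := by
  induction l, hjl using Nat.le_induction with
  | base => rw [push_self]
  | succ l hl ih => rw [push_succ M hl, push_succ M (hij.trans hl), ih]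

/-- The map from level `j` to level `i ≤ j` is linear. -/
noncomputable def pushLin (j i : ℕ) (h : i ≤ j) : (Fin (k j) → ℝ) →ₗ[ℝ] (Fin (k i) → ℝ) where
  toFun v := push M j v i
  map_add' v v' := by
    induction j, h using Nat.le_induction with
    | base => simp [push_self]
    | succ j hj ih => simp only [push_succ M hj, Matrix.mulVec_add, ih]
  map_smul' t v := by
    induction j, h using Nat.le_induction with
    | base => simp [push_self]
    | succ j hj ih => simpa [push_succ M hj, Matrix.mulVec_smul] using ih _

theorem pushLin_apply {i j : ℕ} (h : i ≤ j) (v : Fin (k j) → ℝ) : pushLin M j i h v = push M j v i :=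
  rfl

theorem push_sub {i j : ℕ} (h : i ≤ j) (v v' : Fin (k j) → ℝ) :
    push M j (v - v') i = push M j v i - push M j v' i := map_sub (pushLin M j i h) v v'

theorem continuous_push {i j : ℕ} (h : i ≤ j) : Continuous fun v => push M j v i :=
  (pushLin M j i h).continuous_of_finiteDimensional

variable {M} {p : ℕ → ℕ}

theorem sum_mulVec (hM : IsManaged p k M) (n : ℕ) (v : Fin (k (n + 1)) → ℝ) :
    ∑ i, ((M n).map (Nat.cast : ℕ → ℝ)).mulVec v i = (p (n + 1) : ℝ) / p n * ∑ l, v l := by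
  simp only [Matrix.mulVec, dotProduct]
  rw [Finset.sum_comm, Finset.mul_sum]
  refine Finset.sum_congr rfl fun l _ => ?_
  rw [← Finset.sum_mul, ← hM.column_sum n l]
  simp

theorem l1_mulVec_le (hM : IsManaged p k M) (n : ℕ) (v : Fin (k (n + 1)) → ℝ) :
    l1 (((M n).map (Nat.cast : ℕ → ℝ)).mulVec v) ≤ (p (n + 1) : ℝ) / p n * l1 v := by
  rw [l1, l1, ← sum_mulVec hM n fun l => |v l|]
  refine Finset.sum_le_sum fun i _ => ?_
  simp only [Matrix.mulVec, dotProduct]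
  refine (Finset.abs_sum_le_sum_abs _ _).trans_eq (Finset.sum_congr rfl fun l _ => ?_)
  simp [abs_mul]

/-- The column sums `p (n + 1) / p n` make every transition map a contraction for the scaled norms
`p n * l1`; all errors are measured in these norms. -/
theorem mul_l1_push_le (hM : IsManaged p k M) (hp : ∀ n, 0 < p n) {i j : ℕ} (h : i ≤ j)
    (v : Fin (k j) → ℝ) : p i * l1 (push M j v i) ≤ p j * l1 v := by
  induction j, h using Nat.le_induction with
  | base => rw [push_self]
  | succ j hj ih =>
    rw [push_succ M hj]
    refine (ih _).trans ?_
    have hpj : (0 : ℝ) < p j := by exact_mod_cast hp j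
    refine (mul_le_mul_of_nonneg_left (l1_mulVec_le hM j v) hpj.le).trans_eq ?_
    field_simp

theorem push_nonneg {i j : ℕ} (h : i ≤ j) {v : Fin (k j) → ℝ} (hv : ∀ l, 0 ≤ v l) (l : Fin (k i)) :
    0 ≤ push M j v i l := by
  induction j, h using Nat.le_induction with
  | base => rw [push_self]; exact hv l
  | succ j hj ih =>
    rw [push_succ M hj]
    refine ih fun l => ?_
    simp only [Matrix.mulVec, dotProduct]
    exact Finset.sum_nonneg fun l' _ => mul_nonneg (by simp) (hv l')

theorem mul_sum_push (hM : IsManaged p k M) (hp : ∀ n, 0 < p n) {i j : ℕ} (h : i ≤ j)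
    (v : Fin (k j) → ℝ) : p i * ∑ l, push M j v i l = p j * ∑ l, v l := by
  induction j, h using Nat.le_induction with
  | base => rw [push_self]
  | succ j hj ih =>
    have hpj : (0 : ℝ) < p j := by exact_mod_cast hp j
    rw [push_succ M hj, ih, sum_mulVec hM]
    field_simp

theorem push_mem_scaledSimplex (hM : IsManaged p k M) (hp : ∀ n, 0 < p n) {i j : ℕ} (h : i ≤ j)
    {v : Fin (k j) → ℝ} (hv : v ∈ scaledSimplex (k j) (p j)) :
    push M j v i ∈ scaledSimplex (k i) (p i) := by
  refine ⟨push_nonneg h hv.1, ?_⟩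
  have := mul_sum_push hM hp h v
  have hpi : (0 : ℝ) < p i := by exact_mod_cast hp i
  have hpj : (0 : ℝ) < p j := by exact_mod_cast hp j
  rw [hv.2] at this
  field_simp at this ⊢
  linarith

theorem push_of_mem_inverseLimit {z : ∀ n, Fin (k n) → ℝ} (hz : z ∈ inverseLimit p k M) {i j : ℕ}
    (h : i ≤ j) : push M j (z j) i = z i := by
  induction j, h using Nat.le_induction with
  | base => rw [push_self]
  | succ j hj ih => rw [push_succ M hj, ← hz.2 j, ih]

variable (p M) in
/-- Vectors in a subsequence of levels that satisfy the equations of the inverse limit up to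
geometrically small errors. -/
structure IsApproxSolution (m : ℕ → ℕ) (b : ∀ n, Fin (k (m n)) → ℝ) : Prop where
  mem : ∀ n, b n ∈ scaledSimplex (k (m n)) (p (m n))
  close : ∀ n, p (m n) * l1 (b n - push M (m (n + 1)) (b (n + 1)) (m n)) ≤ (1 / 2 : ℝ) ^ n

variable (p) in
/-- `z` is the exact solution shadowed by `b`. -/
def Shadows (m : ℕ → ℕ) (b : ∀ n, Fin (k (m n)) → ℝ) (z : ∀ n, Fin (k n) → ℝ) : Prop :=
  ∀ n, p (m n) * l1 (b n - z (m n)) ≤ 2 * (1 / 2 : ℝ) ^ n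

variable {m : ℕ → ℕ}

theorem Shadows.l1_push_sub_le (hM : IsManaged p k M) (hp : ∀ n, 0 < p n)
    {b : ∀ n, Fin (k (m n)) → ℝ} {z : ∀ n, Fin (k n) → ℝ} (hz : z ∈ inverseLimit p k M)
    (h : Shadows p m b z) {i n : ℕ} (hi : i ≤ m n) :
    l1 (push M (m n) (b n) i - z i) ≤ 2 * (1 / 2 : ℝ) ^ n := by
  have h1 := mul_l1_push_le hM hp hi (b n - z (m n))
  rw [push_sub M hi, push_of_mem_inverseLimit hz hi] at h1
  refine le_trans ?_ (h1.trans (h n))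
  have : (1 : ℝ) ≤ p i := by exact_mod_cast hp i
  exact le_mul_of_one_le_left (l1_nonneg _) this

theorem tendsto_two_mul_half_pow : Tendsto (fun n : ℕ => 2 * (1 / 2 : ℝ) ^ n) atTop (𝓝 0) := by
  simpa using (tendsto_pow_atTop_nhds_zero_of_lt_one (r := (1 / 2 : ℝ)) (by norm_num)
    (by norm_num)).const_mul 2

theorem Shadows.unique (hM : IsManaged p k M) (hp : ∀ n, 0 < p n) (hm : StrictMono m)
    {b : ∀ n, Fin (k (m n)) → ℝ} {z z' : ∀ n, Fin (k n) → ℝ} (hz : z ∈ inverseLimit p k M)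
    (hz' : z' ∈ inverseLimit p k M) (h : Shadows p m b z) (h' : Shadows p m b z') : z = z' := by
  funext i
  refine eq_of_l1_le_zero ?_
  have hlim : Tendsto (fun n : ℕ => 2 * (1 / 2 : ℝ) ^ n + 2 * (1 / 2 : ℝ) ^ n) atTop (𝓝 0) := by
    simpa using tendsto_two_mul_half_pow.add tendsto_two_mul_half_pow
  refine ge_of_tendsto hlim ?_
  filter_upwards [eventually_ge_atTop i] with n hn
  have hi : i ≤ m n := hn.trans (hm.id_le n)
  refine (l1_sub_le _ (push M (m n) (b n) i) _).trans (add_le_add ?_ (h'.l1_push_sub_le hM hp hz' hi))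
  rw [l1_sub_comm]
  exact h.l1_push_sub_le hM hp hz hi

/-- The right-hand side is the sum of the errors `(1/2)^s` for `n ≤ s < n + r`, in closed form. -/
theorem IsApproxSolution.l1_push_sub_push_le (hM : IsManaged p k M) (hp : ∀ n, 0 < p n)
    (hm : StrictMono m) {b : ∀ n, Fin (k (m n)) → ℝ} (h : IsApproxSolution M p m b) {i n : ℕ}
    (hi : i ≤ m n) (r : ℕ) :
    p i * l1 (push M (m n) (b n) i - push M (m (n + r)) (b (n + r)) i) ≤
      2 * (1 / 2 : ℝ) ^ n - 2 * (1 / 2 : ℝ) ^ (n + r) := by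
  induction r with
  | zero => simp [l1]
  | succ r ih =>
    have hir : i ≤ m (n + r) := hi.trans (hm.monotone (Nat.le_add_right _ _))
    have hstep : p i * l1 (push M (m (n + r)) (b (n + r)) i -
        push M (m (n + r + 1)) (b (n + r + 1)) i) ≤ (1 / 2 : ℝ) ^ (n + r) := by
      rw [← push_push M hir (hm.monotone (Nat.le_succ (n + r))), ← push_sub M hir]
      exact (mul_l1_push_le hM hp hir _).trans (h.close (n + r))
    have hpi : (0 : ℝ) ≤ p i := by positivity
    have := mul_le_mul_of_nonneg_left (l1_sub_le (push M (m n) (b n) i)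
      (push M (m (n + r)) (b (n + r)) i) (push M (m (n + r + 1)) (b (n + r + 1)) i)) hpi
    rw [mul_add] at this
    refine this.trans ((add_le_add ih hstep).trans_eq ?_)
    rw [← add_assoc, pow_succ]
    ring

theorem isClosed_scaledSimplex (k p : ℕ) : IsClosed (scaledSimplex k p) := by
  refine IsClosed.inter (s₁ := {x : Fin k → ℝ | ∀ i, 0 ≤ x i}) (s₂ := {x | ∑ i, x i = 1 / (p : ℝ)})
    ?_ ?_
  · simp only [Set.ofPred_forall]
    exact isClosed_iInter fun i => isClosed_le continuous_const (continuous_apply i)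
  · exact isClosed_eq (continuous_finsetSum _ fun i _ => continuous_apply i) continuous_const

theorem IsApproxSolution.exists_shadows (hM : IsManaged p k M) (hp : ∀ n, 0 < p n)
    (hm : StrictMono m) {b : ∀ n, Fin (k (m n)) → ℝ} (h : IsApproxSolution M p m b) :
    ∃ z ∈ inverseLimit p k M, Shadows p m b z := by
  have hcau : ∀ i, ∃ y, Tendsto (fun n => push M (m n) (b n) i) atTop (𝓝 y) := by
    intro i
    -- The offset `i` ensures `i ≤ m (n + i)`, so that no vector is pushed upwards.
    have hc : CauchySeq fun n => push M (m (n + i)) (b (n + i)) i := by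
      refine cauchySeq_of_le_geometric (1 / 2) 1 (by norm_num) fun n => ?_
      have hi : i ≤ m (n + i) := (Nat.le_add_left i n).trans (hm.id_le _)
      have h1 := h.l1_push_sub_push_le hM hp hm hi 1
      have hp1 : (1 : ℝ) ≤ p i := by exact_mod_cast hp i
      rw [dist_eq_norm, show n + 1 + i = n + i + 1 by omega]
      refine (norm_le_l1 _).trans ((le_mul_of_one_le_left (l1_nonneg _) hp1).trans (h1.trans ?_))
      rw [one_mul, pow_succ, pow_add]
      have : (1 / 2 : ℝ) ^ n * (1 / 2) ^ i ≤ (1 / 2 : ℝ) ^ n :=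
        mul_le_of_le_one_right (by positivity) (pow_le_one₀ (by norm_num) (by norm_num))
      linarith
    obtain ⟨y, hy⟩ := cauchySeq_tendsto_of_complete hc
    exact ⟨y, (tendsto_add_atTop_iff_nat (f := fun n => push M (m n) (b n) i) i).1 hy⟩
  choose z hz using hcau
  refine ⟨z, ⟨fun i => ?_, fun i => ?_⟩, fun n => ?_⟩
  · refine (isClosed_scaledSimplex _ _).mem_of_tendsto (hz i) ?_
    filter_upwards [eventually_ge_atTop i] with n hn
    exact push_mem_scaledSimplex hM hp (hn.trans (hm.id_le n)) (h.mem n)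
  · refine tendsto_nhds_unique (hz i) ?_
    have hcont : Continuous fun v => ((M i).map (Nat.cast : ℕ → ℝ)).mulVec v :=
      (Matrix.mulVecLin ((M i).map (Nat.cast : ℕ → ℝ))).continuous_of_finiteDimensional
    refine ((hcont.tendsto _).comp (hz (i + 1))).congr' ?_
    filter_upwards [eventually_ge_atTop (i + 1)] with n hn
    exact (push_eq_mulVec M (lt_of_lt_of_le hn (hm.id_le n)) (b n)).symm
  · have hlim : Tendsto (fun r => p (m n) * l1 (b n - push M (m (n + r)) (b (n + r)) (m n))) atTop
        (𝓝 (p (m n) * l1 (b n - z (m n)))) := by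
      refine ((continuous_l1.tendsto _).comp (tendsto_const_nhds.sub ?_)).const_mul _
      have := (tendsto_add_atTop_iff_nat (f := fun r => push M (m r) (b r) (m n)) n).2 (hz (m n))
      exact this.congr fun r => by rw [add_comm r n]
    refine le_of_tendsto hlim (Eventually.of_forall fun r => ?_)
    have := h.l1_push_sub_push_le hM hp hm (le_refl (m n)) r
    rw [push_self] at this
    refine this.trans ?_
    have : (0 : ℝ) ≤ (1 / 2) ^ (n + r) := by positivity
    linarith

/-- Each coordinate is a uniform limit of continuous maps, since the shadowing error does not depend
on `y`. -/
theorem continuous_of_shadows (hM : IsManaged p k M) (hp : ∀ n, 0 < p n) (hm : StrictMono m)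
    {Y : Type*} [TopologicalSpace Y] {b : Y → ∀ n, Fin (k (m n)) → ℝ} (hb : ∀ n, Continuous fun y => b y n)
    {z : Y → ∀ n, Fin (k n) → ℝ} (hz : ∀ y, z y ∈ inverseLimit p k M)
    (h : ∀ y, Shadows p m (b y) (z y)) : Continuous z := by
  refine continuous_pi fun i => ?_
  refine TendstoUniformly.continuous (F := fun n y => push M (m (n + i)) (b y (n + i)) i) (p := atTop)
    ?_ (Frequently.of_forall fun n => ?_)
  · rw [Metric.tendstoUniformly_iff]
    intro ε hε
    have := (tendsto_add_atTop_iff_nat i).2 tendsto_two_mul_half_pow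
    filter_upwards [this.eventually (gt_mem_nhds hε)] with n hn y
    rw [dist_comm, dist_eq_norm]
    refine (norm_le_l1 _).trans_lt (lt_of_le_of_lt ?_ hn)
    exact (h y).l1_push_sub_le hM hp (hz y) ((Nat.le_add_left i n).trans (hm.id_le _))
  · exact (continuous_push M ((Nat.le_add_left i n).trans (hm.id_le _))).comp (hb _)

theorem convex_combination_mem_inverseLimit {z z' : ∀ n, Fin (k n) → ℝ} (hz : z ∈ inverseLimit p k M)
    (hz' : z' ∈ inverseLimit p k M) {t : ℝ} (h0 : 0 ≤ t) (h1 : t ≤ 1) :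
    t • z + (1 - t) • z' ∈ inverseLimit p k M := by
  refine ⟨fun n => ⟨fun i => ?_, ?_⟩, fun n => ?_⟩
  · exact add_nonneg (mul_nonneg h0 ((hz.1 n).1 i)) (mul_nonneg (by linarith) ((hz'.1 n).1 i))
  · simp only [Pi.add_apply, Pi.smul_apply, smul_eq_mul, Finset.sum_add_distrib, ← Finset.mul_sum,
      (hz.1 n).2, (hz'.1 n).2]
    ring
  · simp only [Pi.add_apply, Pi.smul_apply, Matrix.mulVec_add, Matrix.mulVec_smul, ← hz.2 n, ← hz'.2 n]

theorem Shadows.convex_combination {b b' : ∀ n, Fin (k (m n)) → ℝ} {z z' : ∀ n, Fin (k n) → ℝ}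
    (h : Shadows p m b z) (h' : Shadows p m b' z') {t : ℝ} (h0 : 0 ≤ t) (h1 : t ≤ 1) :
    Shadows p m (t • b + (1 - t) • b') (t • z + (1 - t) • z') := by
  intro n
  have e : (t • b + (1 - t) • b') n - (t • z + (1 - t) • z') (m n) =
      t • (b n - z (m n)) + (1 - t) • (b' n - z' (m n)) := by
    simp only [Pi.add_apply, Pi.smul_apply, smul_sub]; abel
  have hle := l1_add_le (t • (b n - z (m n))) ((1 - t) • (b' n - z' (m n)))
  rw [l1_smul, l1_smul, abs_of_nonneg h0, abs_of_nonneg (by linarith : 0 ≤ 1 - t)] at hle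
  rw [e]
  have hp0 : (0 : ℝ) ≤ p (m n) := by positivity
  have := mul_le_mul_of_nonneg_left hle hp0
  nlinarith [mul_le_mul_of_nonneg_left (h n) h0,
    mul_le_mul_of_nonneg_left (h' n) (by linarith : 0 ≤ 1 - t)]

end InverseLimit

/-! ### Measures on subshifts -/

namespace Subshift

variable {G : Type u} [Group G] {m : ℕ} (X : Subshift G m)

/-- A set that depends on finitely many coordinates only. -/
def IsLocalSet (A : Set X.carrier) : Prop :=
  ∃ E : Finset G, ∀ x y : X.carrier, (∀ e ∈ E, x.1 e = y.1 e) → (x ∈ A ↔ y ∈ A)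

instance : CompactSpace X.carrier := isCompact_iff_compactSpace.1 X.isClosed.isCompact

variable {X}

theorem IsLocalSet.isClopen {A : Set X.carrier} (h : X.IsLocalSet A) : IsClopen A := by
  obtain ⟨E, hE⟩ := h
  let r : X.carrier → E → Fin m := fun x e => x.1 e
  have hr : Continuous r := continuous_pi fun e => (continuous_apply _).comp continuous_subtype_val
  have : A = r ⁻¹' (r '' A) := by
    refine subset_antisymm (Set.subset_preimage_image r A) ?_
    rintro x ⟨y, hy, hxy⟩
    exact (hE y x fun e he => congrFun hxy ⟨e, he⟩).1 hy
  rw [this]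
  exact (isClopen_discrete _).preimage hr

theorem IsLocalSet.inter {A B : Set X.carrier} (hA : X.IsLocalSet A) (hB : X.IsLocalSet B) :
    X.IsLocalSet (A ∩ B) := by
  classical
  obtain ⟨E, hE⟩ := hA
  obtain ⟨E', hE'⟩ := hB
  refine ⟨E ∪ E', fun x y h => and_congr (hE x y fun e he => h e ?_) (hE' x y fun e he => h e ?_)⟩ <;>
    simp [he]

theorem continuous_shiftMap (g : G) : Continuous (X.shiftMap g) :=
  Continuous.subtype_mk (f := fun x : X.carrier => shift g x.1)
    (continuous_pi fun h => (continuous_apply (g⁻¹ * h)).comp continuous_subtype_val) _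

variable [Countable G]

theorem generateFrom_isLocalSet :
    (inferInstance : MeasurableSpace X.carrier) = MeasurableSpace.generateFrom {A | X.IsLocalSet A} := by
  refine le_antisymm ?_ (MeasurableSpace.generateFrom_le fun A hA => hA.isClopen.isOpen.measurableSet)
  refine Measurable.comap_le (m₁ := MeasurableSpace.generateFrom {A | X.IsLocalSet A}) ?_
  refine @measurable_pi_lambda _ _ _ (_) _ _ fun g => ?_
  refine @measurable_to_countable' _ _ _ _ (_) _ fun a => ?_
  refine MeasurableSpace.measurableSet_generateFrom ⟨{g}, fun x y h => ?_⟩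
  simp [h g (by simp)]

theorem ext_of_isLocalSet {μ ν : Measure X.carrier} [IsProbabilityMeasure μ] [IsProbabilityMeasure ν]
    (h : ∀ A, X.IsLocalSet A → μ.real A = ν.real A) : μ = ν := by
  refine ext_of_generate_finite _ generateFrom_isLocalSet
    (fun A hA B hB _ => hA.inter hB) (fun A hA => ?_) (by simp)
  simpa [measureReal_def, ENNReal.toReal_eq_toReal_iff'] using h A hA

/-- The inequality for `g⁻¹` gives the reverse one, and clopen sets determine the measure. This
one-sided form is stable under weak limits. -/
theorem mem_invariantMeasures_iff {μ : ProbabilityMeasure X.carrier} :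
    μ ∈ X.invariantMeasures ↔ ∀ g, ∀ A, IsClopen A →
      (μ : Measure X.carrier).real (X.shiftMap g ⁻¹' A) ≤ (μ : Measure X.carrier).real A := by
  constructor
  · intro h g A hA
    have := h g⁻¹ A hA.isOpen.measurableSet
    rw [TileSystem.image_shiftMap, inv_inv] at this
    rw [measureReal_def, measureReal_def, this]
  · intro h g s hs
    have hmeas : Measurable (X.shiftMap g⁻¹) := (continuous_shiftMap g⁻¹).measurable
    have hp : IsProbabilityMeasure ((μ : Measure X.carrier).map (X.shiftMap g⁻¹)) :=
      Measure.isProbabilityMeasure_map hmeas.aemeasurable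
    have key : (μ : Measure X.carrier).map (X.shiftMap g⁻¹) = μ := by
      refine ext_of_isLocalSet fun A hA => ?_
      have hA' := hA.isClopen
      rw [map_measureReal_apply hmeas hA'.isOpen.measurableSet]
      refine le_antisymm (h _ _ hA') ?_
      have := h g _ (hA'.preimage (continuous_shiftMap g⁻¹))
      rwa [← Set.preimage_comp, show X.shiftMap g⁻¹ ∘ X.shiftMap g = id from
        funext fun x => by simp [← TileSystem.shiftMap_mul, TileSystem.shiftMap_one]] at this
    rw [TileSystem.image_shiftMap, ← Measure.map_apply hmeas hs, key]

theorem continuous_measureReal {A : Set X.carrier} (hA : IsClopen A) :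
    Continuous fun μ : ProbabilityMeasure X.carrier => (μ : Measure X.carrier).real A := by
  rw [continuous_iff_continuousAt]
  intro μ
  exact (NNReal.continuous_coe.tendsto _).comp
    (ProbabilityMeasure.tendsto_measure_of_isClopen_of_tendsto tendsto_id hA)

theorem isClosed_invariantMeasures : IsClosed X.invariantMeasures := by
  have : X.invariantMeasures = ⋂ (g : G) (A : Set X.carrier) (_ : IsClopen A),
      {μ : ProbabilityMeasure X.carrier | (μ : Measure X.carrier).real (X.shiftMap g ⁻¹' A) ≤ (μ : Measure X.carrier).real A} := by
    ext μ
    simp [mem_invariantMeasures_iff]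
  rw [this]
  exact isClosed_iInter fun g => isClosed_iInter fun A => isClosed_iInter fun hA =>
    isClosed_le (continuous_measureReal (hA.preimage (continuous_shiftMap g)))
      (continuous_measureReal hA)

instance : CompactSpace X.invariantMeasures :=
  isCompact_iff_compactSpace.1 isClosed_invariantMeasures.isCompact

end Subshift

/-! ### Measure-theoretic consequences of the Følner property. -/

namespace TileSystem

variable {G : Type u} [Group G] (S : TileSystem G)

/-- The tiles are right Følner sets. -/
def Folner : Prop := ∀ g : G, Tendsto
  (fun n => ((S.F n : Set G) ∩ {f | f * g ∉ S.F n}).ncard / ((S.F n).card : ℝ)) atTop (𝓝 0)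

theorem card_F_pos (n : ℕ) : 0 < (S.F n).card := Finset.card_pos.2 ⟨1, S.one_mem_F n⟩

/-- The exceptional points are those for which, for some `g`, no level has a tile containing both
`1` and `g`. At level `n` this has measure at most the proportion of `f ∈ F n` with `f * g ∉ F n`.
-/
theorem isFullMeasure_isFreeOn [Countable G] (hF : S.Folner) :
    ∃ A, S.subshift.IsFullMeasure A ∧ S.subshift.IsFreeOn A := by
  classical
  let A : G → ℕ → Set S.subshift.carrier := fun g n =>
    ⋃ f ∈ (S.F n).filter (fun f => f * g ∉ S.F n), ⋃ j, S.cyl n f⁻¹ j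
  refine ⟨(⋃ g, ⋂ n, A g n)ᶜ, fun μ hμ => ?_, fun x hx g hg => ?_⟩
  · rw [compl_compl, measure_iUnion_null_iff]
    intro g
    rw [← measureReal_eq_zero_iff]
    refine le_antisymm (ge_of_tendsto (hF g) (Eventually.of_forall fun n => ?_)) measureReal_nonneg
    refine (measureReal_mono (Set.iInter_subset _ n) (measure_ne_top _ _)).trans ?_
    refine (measureReal_biUnion_finset_le _ _).trans ?_
    have hsum : ∀ f ∈ (S.F n).filter (fun f => f * g ∉ S.F n),
        (μ : Measure S.subshift.carrier).real (⋃ j, S.cyl n f⁻¹ j) ≤ 1 / (S.F n).card := by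
      intro f _
      refine (measureReal_iUnion_fintype_le _).trans_eq ?_
      rw [Finset.sum_congr rfl fun j _ => S.measureReal_cyl hμ n f⁻¹ j, eq_div_iff, mul_comm,
        S.card_mul_sum_freq hμ]
      exact_mod_cast (S.card_F_pos n).ne'
    refine (Finset.sum_le_sum hsum).trans_eq ?_
    rw [Finset.sum_const, nsmul_eq_mul, mul_one_div, ← Set.ncard_coe_finset]
    congr 3
    ext; simp
  · simp only [Set.mem_compl_iff, Set.mem_iUnion, Set.mem_iInter, not_exists, not_forall] at hx
    obtain ⟨n, hn⟩ := hx g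
    obtain ⟨f, hf, j, hj⟩ := S.exists_tile_mem x.2 n 1
    rw [one_mul] at hj
    refine S.shift_eq_of_same_tile x.2 (a := 1) hj (by simpa using hf) ?_ (congrArg Subtype.val hg)
    by_contra hfg
    refine hn (Set.mem_biUnion (x := f) ?_ (Set.mem_iUnion.2 ⟨j, hj⟩))
    simpa [hf] using hfg

/-- When the window of a local event lies inside the tile covering the identity, the label and
position of this tile decide the event; otherwise the identity is near the boundary of its tile,
which is rare by the Følner property. -/
theorem measureReal_eq_of_freq_eq [Countable G] (hF : S.Folner)
    {μ ν : ProbabilityMeasure S.subshift.carrier} (hμ : μ ∈ S.subshift.invariantMeasures)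
    (hν : ν ∈ S.subshift.invariantMeasures) (h : ∀ n j, S.freq μ n j = S.freq ν n j) : μ = ν := by
  classical
  refine Subtype.ext ?_
  change (μ : Measure S.subshift.carrier) = ν
  refine Subshift.ext_of_isLocalSet fun A hA => ?_
  have hAm := hA.isClopen.isOpen.measurableSet
  obtain ⟨E, hE⟩ := hA
  refine eq_of_abs_sub_nonpos ?_
  have hlim : Tendsto (fun n => ∑ e ∈ E, ((S.F n : Set G) ∩ {f | f * e ∉ S.F n}).ncard /
      ((S.F n).card : ℝ)) atTop (𝓝 0) := by
    simpa using tendsto_finsetSum E fun e _ => hF e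
  refine ge_of_tendsto hlim (Eventually.of_forall fun n => ?_)
  rw [S.measureReal_eq_sum μ hAm n, S.measureReal_eq_sum ν hAm n, ← Finset.sum_sub_distrib]
  have hpos : (0 : ℝ) < (S.F n).card := by exact_mod_cast S.card_F_pos n
  have hterm : ∀ f ∈ S.F n,
      |∑ j, (μ : Measure S.subshift.carrier).real (A ∩ S.cyl n f⁻¹ j) -
        ∑ j, (ν : Measure S.subshift.carrier).real (A ∩ S.cyl n f⁻¹ j)| ≤
      if ∃ e ∈ E, f * e ∉ S.F n then 1 / ((S.F n).card : ℝ) else 0 := by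
    intro f hf
    rw [← Finset.sum_sub_distrib]
    split_ifs with hbad
    · refine (Finset.abs_sum_le_sum_abs _ _).trans ?_
      rw [le_div_iff₀ hpos, mul_comm, ← S.card_mul_sum_freq hμ n]
      gcongr with j
      have h1 := measureReal_mono (μ := (μ : Measure S.subshift.carrier))
        (Set.inter_subset_right (s := A) (t := S.cyl n f⁻¹ j))
      have h2 := measureReal_mono (μ := (ν : Measure S.subshift.carrier))
        (Set.inter_subset_right (s := A) (t := S.cyl n f⁻¹ j))
      rw [S.measureReal_cyl hμ] at h1
      rw [S.measureReal_cyl hν, ← h] at h2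
      rw [abs_le]
      constructor <;> linarith [measureReal_nonneg (μ := (μ : Measure S.subshift.carrier))
        (s := A ∩ S.cyl n f⁻¹ j), measureReal_nonneg (μ := (ν : Measure S.subshift.carrier))
        (s := A ∩ S.cyl n f⁻¹ j)]
    · push Not at hbad
      refine (abs_eq_zero.2 (Finset.sum_eq_zero fun j _ => ?_)).le
      have hloc : ∀ x ∈ S.cyl n f⁻¹ j, ∀ y ∈ S.cyl n f⁻¹ j, x ∈ A → y ∈ A := by
        intro x hx y hy hxA
        refine (hE x y fun e he => ?_).1 hxA
        simpa using Tile.eq_on hx hy (f * e) (hbad e he)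
      rcases (A ∩ S.cyl n f⁻¹ j).eq_empty_or_nonempty with h0 | ⟨x, hxA, hx⟩
      · simp [h0]
      · rw [Set.inter_eq_right.2 fun y hy => hloc x hx y hy hxA, S.measureReal_cyl hμ,
          S.measureReal_cyl hν, h, sub_self]
  refine (Finset.abs_sum_le_sum_abs _ _).trans ((Finset.sum_le_sum hterm).trans ?_)
  rw [← Finset.sum_filter, Finset.sum_const, nsmul_eq_mul, mul_one_div, ← Finset.sum_div]
  gcongr
  rw [← Set.ncard_coe_finset, ← Nat.cast_sum, Nat.cast_le]
  refine le_trans (Set.ncard_le_ncard (t := ⋃ e ∈ E, (S.F n : Set G) ∩ {f | f * e ∉ S.F n}) ?_ ?_)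
    (Finset.set_ncard_biUnion_le _ _)
  · intro f hf
    simpa using hf
  · exact E.finite_toSet.biUnion fun e _ => (S.F n).finite_toSet.inter_of_left _

end TileSystem

namespace TileSystem

variable {G : Type u} [Group G] (S : TileSystem G)

/-! ### Empirical measures -/

/-- The number of tiles of level `r` with label `i` rooted in the tile of level `n` at the
identity. -/
noncomputable def occ (n : ℕ) (x : G → Fin S.alph) (r : ℕ) (i : S.L r) : ℕ :=
  ((S.F n : Set G) ∩ {f | S.Tile r x f i}).ncard

theorem occ_self {n : ℕ} {x : G → Fin S.alph} (hx : x ∈ S.subshift.carrier) {j : S.L n}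
    (hj : S.Tile n x 1 j) (i : S.L n) [Decidable (i = j)] :
    S.occ n x n i = if i = j then 1 else 0 := by
  have h1 : ∀ f ∈ S.F n, S.Tile n x f i → f = 1 := fun f hf hi =>
    S.tile_unique hx hi hj (a := f) (by simpa using S.one_mem_F n) (by simpa using hf)
  split_ifs with hij
  · subst hij
    refine Set.ncard_eq_one.2 ⟨1, ?_⟩
    ext f
    refine ⟨fun h => h1 f h.1 h.2, ?_⟩
    rintro rfl
    exact ⟨S.one_mem_F n, hj⟩
  · rw [occ, Set.ncard_eq_zero ((S.F n).finite_toSet.inter_of_left _)]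
    refine Set.eq_empty_of_forall_notMem fun f hf => hij ?_
    have := hf.2
    rw [h1 f hf.1 hf.2] at this
    exact Tile.label_unique this hj

/-- For `r < n` the parent of a tile inside the big tile is also inside it, so each tile is counted
once through its parent. -/
theorem occ_step {n r : ℕ} (hr : r < n) {x : G → Fin S.alph} (hx : x ∈ S.subshift.carrier)
    {j : S.L n} (hj : S.Tile n x 1 j) (i : S.L r) :
    S.occ n x r i = ∑ j', S.count r i j' * S.occ n x (r + 1) j' := by
  classical
  have hocc : ∀ r i, S.occ n x r i = ((S.F n).filter fun f => S.Tile r x f i).card := by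
    intro r i
    rw [occ, ← Set.ncard_coe_finset]
    congr 1
    ext; simp
  have hU : (S.F n).filter (fun f => S.Tile r x f i) =
      Finset.univ.biUnion fun j' => (((S.J r).filter fun d => S.w r j' d = i) ×ˢ
        ((S.F n).filter fun f => S.Tile (r + 1) x f j')).image fun q => q.2 * q.1 := by
    ext f
    simp only [Finset.mem_filter, Finset.mem_biUnion, Finset.mem_univ, true_and, Finset.mem_image,
      Finset.mem_product, Prod.exists]
    constructor
    · rintro ⟨hf, hi⟩
      obtain ⟨j', d, hd, hj', hw⟩ := S.exists_parent_one hx hi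
      have := S.tile_nested (a := f) hr hx hj' hj (by simpa using S.J_subset r hd) (by simpa using hf)
        1 (S.one_mem_F _)
      exact ⟨j', d, f * d⁻¹, ⟨⟨hd, hw⟩, by simpa using this, hj'⟩, by simp⟩
    · rintro ⟨j', d, f, ⟨⟨hd, rfl⟩, hf, hj'⟩, rfl⟩
      have := S.tile_nested (a := f) hr hx hj' hj (by simpa using S.one_mem_F _) (by simpa using hf)
        d (S.J_subset r hd)
      exact ⟨by simpa using this, hj' d hd⟩
  rw [hocc, hU, Finset.card_biUnion]
  · refine Finset.sum_congr rfl fun j' _ => ?_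
    rw [Finset.card_image_of_injOn, Finset.card_product, hocc, count]
    rintro ⟨d, f⟩ h ⟨d', f'⟩ h' heq
    simp only [Finset.coe_product, Set.mem_prod, Finset.mem_coe, Finset.mem_filter] at h h' heq
    obtain ⟨rfl, -⟩ := S.parent_unique hx (g := f * d) h.1.1 h'.1.1 (by simpa using h.2.2)
      (by simpa [heq] using h'.2.2)
    simpa using heq
  · intro j₁ _ j₂ _ hne
    refine Finset.disjoint_left.2 fun g h h' => hne ?_
    simp only [Finset.mem_image, Finset.mem_product, Finset.mem_filter, Prod.exists] at h h'
    obtain ⟨d, f, ⟨⟨hd, -⟩, -, hj₁⟩, rfl⟩ := h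
    obtain ⟨d', f', ⟨⟨hd', -⟩, -, hj₂⟩, heq⟩ := h'
    exact (S.parent_unique hx (g := f * d) hd hd' (by simpa using hj₁)
      (by simpa [← heq] using hj₂)).2

/-- The measure that gives weight `c l` to each of the translates of the points `y l` by the
inverses of the elements of the tile of level `n`. -/
noncomputable def empirical {ι : Type*} [Fintype ι] (n : ℕ) (c : ι → ℝ) (y : ι → S.subshift.carrier) :
    Measure S.subshift.carrier :=
  ∑ l, ENNReal.ofReal (c l) • ∑ f ∈ S.F n, Measure.dirac (S.subshift.shiftMap f⁻¹ (y l))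

section Empirical

variable {ι : Type*} [Fintype ι] {n : ℕ} {c : ι → ℝ} (hc : ∀ l, 0 ≤ c l) (y : ι → S.subshift.carrier)
include hc

theorem empirical_apply [Countable G] {A : Set S.subshift.carrier} (hA : MeasurableSet A) :
    (S.empirical n c y).real A =
      ∑ l, c l * ((S.F n : Set G) ∩ {f | S.subshift.shiftMap f⁻¹ (y l) ∈ A}).ncard := by
  classical
  rw [measureReal_def, empirical, Measure.finsetSum_apply, ENNReal.toReal_sum]
  · refine Finset.sum_congr rfl fun l _ => ?_
    rw [Measure.smul_apply, smul_eq_mul, ENNReal.toReal_mul, ENNReal.toReal_ofReal (hc l),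
      Measure.finsetSum_apply]
    simp only [Measure.dirac_apply' _ hA]
    congr 1
    rw [ENNReal.toReal_sum]
    · have : (S.F n : Set G) ∩ {f | S.subshift.shiftMap f⁻¹ (y l) ∈ A} =
          ((S.F n).filter fun f => S.subshift.shiftMap f⁻¹ (y l) ∈ A : Finset G) := by
        ext; simp
      rw [this, Set.ncard_coe_finset, Finset.card_filter, Nat.cast_sum]
      refine Finset.sum_congr rfl fun f _ => ?_
      by_cases h : S.subshift.shiftMap f⁻¹ (y l) ∈ A <;> simp [h]
    · intro f _
      by_cases h : S.subshift.shiftMap f⁻¹ (y l) ∈ A <;> simp [h]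
  · intro l _
    rw [Measure.smul_apply, smul_eq_mul]
    refine ENNReal.mul_ne_top ENNReal.ofReal_ne_top ?_
    rw [Measure.finsetSum_apply]
    exact (ENNReal.sum_lt_top.2 fun f _ => (measure_lt_top _ _)).ne

theorem isProbabilityMeasure_empirical (h1 : ((S.F n).card : ℝ) * ∑ l, c l = 1) :
    IsProbabilityMeasure (S.empirical n c y) := by
  constructor
  simp only [empirical, Measure.finsetSum_apply, Measure.smul_apply, measure_univ, smul_eq_mul,
    Finset.sum_const, nsmul_eq_mul, mul_one]
  rw [← Finset.sum_mul, ← ENNReal.ofReal_sum_of_nonneg fun l _ => hc l, ← ENNReal.ofReal_natCast,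
    ← ENNReal.ofReal_mul (Finset.sum_nonneg fun l _ => hc l), mul_comm, h1, ENNReal.ofReal_one]

theorem empirical_cyl [Countable G] (r : ℕ) (i : S.L r) :
    (S.empirical n c y).real (S.cyl r 1 i) = ∑ l, c l * S.occ n (y l).1 r i := by
  rw [S.empirical_apply hc y (S.measurableSet_cyl r 1 i)]
  refine Finset.sum_congr rfl fun l _ => ?_
  congr 4
  ext f
  simp [cyl, Subshift.shiftMap, tile_shift]

/-- Replacing `f` by `f * g⁻¹` matches the two counts except when this leaves the tile. The error
vanishes in the limit by the Følner property. -/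
theorem empirical_preimage_le [Countable G] (h1 : ((S.F n).card : ℝ) * ∑ l, c l = 1) (g : G)
    {A : Set S.subshift.carrier} (hA : IsClopen A) :
    (S.empirical n c y).real (S.subshift.shiftMap g ⁻¹' A) ≤ (S.empirical n c y).real A +
      ((S.F n : Set G) ∩ {f | f * g⁻¹ ∉ S.F n}).ncard / ((S.F n).card : ℝ) := by
  rw [S.empirical_apply hc y (hA.preimage (Subshift.continuous_shiftMap g)).isOpen.measurableSet,
    S.empirical_apply hc y hA.isOpen.measurableSet]
  have hpos : (0 : ℝ) < (S.F n).card := by exact_mod_cast S.card_F_pos n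
  set B := (S.F n : Set G) ∩ {f | f * g⁻¹ ∉ S.F n} with hB
  have e : (B.ncard : ℝ) / ((S.F n).card : ℝ) = ∑ l, c l * B.ncard := by
    rw [← Finset.sum_mul, div_eq_iff hpos.ne']
    linear_combination (-(B.ncard : ℝ)) * h1
  rw [e, ← Finset.sum_add_distrib]
  refine Finset.sum_le_sum fun l _ => ?_
  rw [← mul_add]
  refine mul_le_mul_of_nonneg_left ?_ (hc l)
  norm_cast
  have hfin : ∀ T : Set G, ((S.F n : Set G) ∩ T).Finite := fun T =>
    (S.F n).finite_toSet.inter_of_left T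
  rw [← Set.ncard_image_of_injective ((S.F n : Set G) ∩ {f | S.subshift.shiftMap f⁻¹ (y l) ∈ A})
    (mul_left_injective g)]
  refine le_trans (Set.ncard_le_ncard ?_ (((hfin _).image _).union (hfin _)))
    (Set.ncard_union_le _ _)
  rintro f ⟨hf, hfA⟩
  by_cases hfg : f * g⁻¹ ∈ S.F n
  · refine Or.inl ⟨f * g⁻¹, ⟨hfg, ?_⟩, by simp⟩
    simpa [← shiftMap_mul] using hfA
  · exact Or.inr ⟨hf, hfg⟩

end Empirical

/-! ### Frequency vectors -/

/-- `v` satisfies the frequency equations up to level `n`. -/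
structure IsFreqUpTo (n : ℕ) (v : ∀ r, S.L r → ℝ) : Prop where
  nonneg : ∀ r i, 0 ≤ v r i
  sum_eq : ∀ r ≤ n, ((S.F r).card : ℝ) * ∑ i, v r i = 1
  step : ∀ r < n, ∀ i, v r i = ∑ j, (S.count r i j : ℝ) * v (r + 1) j

theorem isFreqUpTo_freq [Countable G] {μ : ProbabilityMeasure S.subshift.carrier}
    (hμ : μ ∈ S.subshift.invariantMeasures) (n : ℕ) : S.IsFreqUpTo n (S.freq μ) where
  nonneg r i := S.freq_nonneg r i
  sum_eq r _ := S.card_mul_sum_freq hμ r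
  step r _ i := S.freq_step hμ r i

theorem card_mul_sum_eq {r : ℕ} {v : S.L r → ℝ} {v' : S.L (r + 1) → ℝ}
    (h : ∀ i, v i = ∑ j, (S.count r i j : ℝ) * v' j) :
    ((S.F r).card : ℝ) * ∑ i, v i = (S.F (r + 1)).card * ∑ j, v' j := by
  simp only [h]
  rw [Finset.sum_comm]
  have : ∀ j, ∑ i, (S.count r i j : ℝ) * v' j = (S.J r).card * v' j := fun j => by
    rw [← Finset.sum_mul, ← Nat.cast_sum, S.sum_count]
  simp only [this]
  rw [← Finset.mul_sum, ← S.card_J_mul r]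
  push_cast
  ring

theorem isFreqUpTo_empirical [Countable G] {ι : Type*} [Fintype ι] {n : ℕ} {c : ι → ℝ}
    (hc : ∀ l, 0 ≤ c l) (h1 : ((S.F n).card : ℝ) * ∑ l, c l = 1)
    (y : ι → S.subshift.carrier) {j : ι → S.L n} (hj : ∀ l, S.Tile n (y l).1 1 (j l)) :
    S.IsFreqUpTo n fun r i => (S.empirical n c y).real (S.cyl r 1 i) := by
  classical
  have hstep : ∀ r < n, ∀ i, (S.empirical n c y).real (S.cyl r 1 i) =
      ∑ j, (S.count r i j : ℝ) * (S.empirical n c y).real (S.cyl (r + 1) 1 j) := by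
    intro r hr i
    simp only [S.empirical_cyl hc y, Finset.mul_sum]
    rw [Finset.sum_comm]
    refine Finset.sum_congr rfl fun l _ => ?_
    rw [S.occ_step hr (y l).2 (hj l) i]
    push_cast
    rw [Finset.mul_sum]
    exact Finset.sum_congr rfl fun _ _ => by ring
  refine ⟨fun r i => measureReal_nonneg, fun r hr => ?_, hstep⟩
  have hn : ((S.F n).card : ℝ) * ∑ i, (S.empirical n c y).real (S.cyl n 1 i) = 1 := by
    rw [← h1]
    congr 1
    simp only [S.empirical_cyl hc y, S.occ_self (y _).2 (hj _)]
    rw [Finset.sum_comm]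
    simp
  induction hr using Nat.decreasingInduction with
  | self => exact hn
  | of_succ r hr ih => rw [S.card_mul_sum_eq (hstep r hr), ih]

end TileSystem

/-! ### The simplex of invariant measures -/

/-- The sums of the entries of a vector over the fibres of a map. -/
def fiberSum {ι κ : Type*} [Fintype ι] [DecidableEq κ] (ρ : ι → κ) (v : ι → ℝ) : κ → ℝ :=
  fun l => ∑ i with ρ i = l, v i

section fiberSum

variable {ι κ : Type*} [Fintype ι] [DecidableEq κ] (ρ : ι → κ)

theorem l1_fiberSum_le [Fintype κ] (v : ι → ℝ) : l1 (fiberSum ρ v) ≤ l1 v := by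
  rw [l1, l1, ← Finset.sum_fiberwise (s := Finset.univ) (g := ρ)]
  exact Finset.sum_le_sum fun l _ => Finset.abs_sum_le_sum_abs _ _

theorem fiberSum_sub (v v' : ι → ℝ) : fiberSum ρ (v - v') = fiberSum ρ v - fiberSum ρ v' := by
  funext l
  simp [fiberSum, Finset.sum_sub_distrib]

theorem sum_fiberSum [Fintype κ] (v : ι → ℝ) : ∑ l, fiberSum ρ v l = ∑ i, v i :=
  Finset.sum_fiberwise _ _ _

theorem fiberSum_mul_comp {u : ι → ℝ} (hu : ∀ l, fiberSum ρ u l = 1) (c : κ → ℝ) :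
    fiberSum ρ (fun i => u i * c (ρ i)) = c := by
  funext l
  rw [fiberSum, Finset.sum_congr rfl fun i hi => by rw [(Finset.mem_filter.1 hi).2],
    ← Finset.sum_mul]
  have := hu l
  rw [fiberSum] at this
  rw [this, one_mul]

theorem fiberSum_eq_sum_single (v : ι → ℝ) :
    fiberSum ρ v = ∑ i, v i • (Pi.single (ρ i) 1 : κ → ℝ) := by
  funext l
  simp [fiberSum, Finset.sum_filter, Pi.single_apply, eq_comm]

theorem l1_mul_comp [Fintype κ] {u : ι → ℝ} (hu0 : ∀ i, 0 ≤ u i) (hu : ∀ l, fiberSum ρ u l = 1) (c : κ → ℝ) :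
    l1 (fun i => u i * c (ρ i)) = l1 c := by
  have := sum_fiberSum ρ fun i => u i * |c (ρ i)|
  rw [fiberSum_mul_comp ρ hu fun l => |c l|] at this
  rw [l1, l1, this]
  exact Finset.sum_congr rfl fun i _ => by rw [abs_mul, abs_of_nonneg (hu0 i)]

theorem continuous_fiberSum : Continuous fun v : ι → ℝ => fiberSum ρ v :=
  continuous_pi fun _ => continuous_finsetSum _ fun i _ => continuous_apply i

end fiberSum

namespace TileSystem

variable {G : Type u} [Group G] (S : TileSystem G)

/-- The numbers of subtiles with given labels in the tiles are approximately given by the matrices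
`M`, along the subsequence of levels `m`: the label `i` of level `n` lies over the column `ρ n i`,
and has weight `u n i` among the labels over this column. -/
structure Realizes (p k : ℕ → ℕ) (M : ∀ n, Matrix (Fin (k n)) (Fin (k (n + 1))) ℕ) (m : ℕ → ℕ)
    (ρ : ∀ n, S.L n → Fin (k (m n))) (u : ∀ n, S.L n → ℝ) : Prop where
  card : ∀ n, (S.F n).card = p (m n)
  u_nonneg : ∀ n i, 0 ≤ u n i
  u_sum : ∀ n l, fiberSum (ρ n) (u n) l = 1
  close : ∀ n j, ∑ i, |(S.count n i j : ℝ) -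
    u n i * push M (m (n + 1)) (Pi.single (ρ (n + 1) j) 1) (m n) (ρ n i)| ≤
      (1 / 2 : ℝ) ^ n * (S.J n).card
  exists_label : ∀ n l, ∃ j, ρ n j = l ∧ ∃ x ∈ S.subshift.carrier, S.Tile n x 1 j

/-! ### From invariant measures to the inverse limit and back. -/

section

variable {S} {p k : ℕ → ℕ} {M : ∀ n, Matrix (Fin (k n)) (Fin (k (n + 1))) ℕ} {m : ℕ → ℕ}
  {ρ : ∀ n, S.L n → Fin (k (m n))} {u : ∀ n, S.L n → ℝ}

/-- Up to a small error, the frequencies of level `r` depend only on the index sums of level `r +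
1`: the weights `u` do not involve the label of the parent. -/
theorem Realizes.l1_freq_sub_le (hR : S.Realizes p k M m ρ u) (hm : StrictMono m) {r : ℕ}
    {v : S.L r → ℝ} {v' : S.L (r + 1) → ℝ} (hv' : ∀ j, 0 ≤ v' j)
    (hs : ((S.F (r + 1)).card : ℝ) * ∑ j, v' j = 1)
    (h : ∀ i, v i = ∑ j, (S.count r i j : ℝ) * v' j) :
    p (m r) * l1 (v - fun i => u r i *
      push M (m (r + 1)) (fiberSum (ρ (r + 1)) v') (m r) (ρ r i)) ≤ (1 / 2 : ℝ) ^ r := by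
  have hle : m r ≤ m (r + 1) := hm.monotone (Nat.le_succ r)
  have hpush : ∀ l, push M (m (r + 1)) (fiberSum (ρ (r + 1)) v') (m r) l =
      ∑ j, v' j * push M (m (r + 1)) (Pi.single (ρ (r + 1) j) 1) (m r) l := by
    intro l
    rw [← pushLin_apply M hle, fiberSum_eq_sum_single, map_sum, Finset.sum_apply]
    simp [pushLin_apply]
  have h1 : l1 (v - fun i => u r i *
      push M (m (r + 1)) (fiberSum (ρ (r + 1)) v') (m r) (ρ r i)) ≤
      ∑ j, v' j * ((1 / 2 : ℝ) ^ r * (S.J r).card) := by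
    calc _ ≤ ∑ i, ∑ j, v' j * |(S.count r i j : ℝ) -
          u r i * push M (m (r + 1)) (Pi.single (ρ (r + 1) j) 1) (m r) (ρ r i)| := by
          refine Finset.sum_le_sum fun i _ => ?_
          rw [Pi.sub_apply, h, hpush, Finset.mul_sum, ← Finset.sum_sub_distrib]
          refine (Finset.abs_sum_le_sum_abs _ _).trans_eq (Finset.sum_congr rfl fun j _ => ?_)
          rw [← abs_of_nonneg (hv' j), ← abs_mul, abs_of_nonneg (hv' j)]
          congr 1; ring
      _ = ∑ j, v' j * ∑ i, |(S.count r i j : ℝ) -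
          u r i * push M (m (r + 1)) (Pi.single (ρ (r + 1) j) 1) (m r) (ρ r i)| := by
          rw [Finset.sum_comm]
          simp only [Finset.mul_sum]
      _ ≤ _ := Finset.sum_le_sum fun j _ => mul_le_mul_of_nonneg_left (hR.close r j) (hv' j)
  rw [← hR.card]
  refine (mul_le_mul_of_nonneg_left h1 (by positivity)).trans_eq ?_
  rw [← Finset.sum_mul]
  rw [← S.card_J_mul] at hs
  push_cast at hs
  linear_combination (1 / 2 : ℝ) ^ r * hs

theorem Realizes.l1_fiberSum_sub_le (hR : S.Realizes p k M m ρ u) (hm : StrictMono m) {r : ℕ}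
    {v : S.L r → ℝ} {v' : S.L (r + 1) → ℝ} (hv' : ∀ j, 0 ≤ v' j)
    (hs : ((S.F (r + 1)).card : ℝ) * ∑ j, v' j = 1)
    (h : ∀ i, v i = ∑ j, (S.count r i j : ℝ) * v' j) :
    p (m r) * l1 (fiberSum (ρ r) v - push M (m (r + 1)) (fiberSum (ρ (r + 1)) v') (m r)) ≤
      (1 / 2 : ℝ) ^ r := by
  refine le_trans (mul_le_mul_of_nonneg_left ?_ (by positivity)) (hR.l1_freq_sub_le hm hv' hs h)
  conv_lhs => rw [← fiberSum_mul_comp (ρ r) (hR.u_sum r)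
    (push M (m (r + 1)) (fiberSum (ρ (r + 1)) v') (m r)), ← fiberSum_sub]
  exact l1_fiberSum_le _ _

theorem Realizes.fiberSum_mem (hR : S.Realizes p k M m ρ u) {r n : ℕ} (hr : r ≤ n)
    {v : ∀ r, S.L r → ℝ} (hv : S.IsFreqUpTo n v) :
    fiberSum (ρ r) (v r) ∈ scaledSimplex (k (m r)) (p (m r)) := by
  refine ⟨fun l => Finset.sum_nonneg fun i _ => hv.nonneg r i, ?_⟩
  rw [sum_fiberSum, ← hR.card, eq_div_iff (by exact_mod_cast (S.card_F_pos r).ne'), mul_comm]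
  exact hv.sum_eq r hr

/-- Downward induction from the level `n` where the values agree: each step adds an error `(1/2)^r`,
and `push` contracts the previous errors. -/
theorem Realizes.l1_fiberSum_sub_le_of_eq (hR : S.Realizes p k M m ρ u) (hM : IsManaged p k M)
    (hp : ∀ n, 0 < p n) (hm : StrictMono m) {n : ℕ} {v : ∀ r, S.L r → ℝ} (hv : S.IsFreqUpTo n v)
    {z : ∀ n, Fin (k n) → ℝ} (hz : z ∈ inverseLimit p k M)
    (hzn : fiberSum (ρ n) (v n) = z (m n)) {r : ℕ} (hr : r ≤ n) :
    p (m r) * l1 (fiberSum (ρ r) (v r) - z (m r)) ≤ 2 * (1 / 2 : ℝ) ^ r - 2 * (1 / 2 : ℝ) ^ n := by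
  induction hr using Nat.decreasingInduction with
  | self => simp [hzn, l1]
  | of_succ r hr ih =>
    have hle : m r ≤ m (r + 1) := hm.monotone (Nat.le_succ r)
    have h1 := hR.l1_fiberSum_sub_le hm (hv.nonneg (r + 1)) (hv.sum_eq (r + 1) hr) (hv.step r hr)
    have h2 := mul_l1_push_le hM hp hle (fiberSum (ρ (r + 1)) (v (r + 1)) - z (m (r + 1)))
    rw [push_sub M hle, push_of_mem_inverseLimit hz hle] at h2
    have h3 := mul_le_mul_of_nonneg_left (l1_sub_le (fiberSum (ρ r) (v r))
      (push M (m (r + 1)) (fiberSum (ρ (r + 1)) (v (r + 1))) (m r)) (z (m r)))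
      (Nat.cast_nonneg (α := ℝ) (p (m r)))
    rw [mul_add] at h3
    rw [pow_succ] at ih
    linarith

variable [Countable G]

theorem Realizes.isApproxSolution (hR : S.Realizes p k M m ρ u) (hm : StrictMono m)
    {μ : ProbabilityMeasure S.subshift.carrier} (hμ : μ ∈ S.subshift.invariantMeasures) :
    IsApproxSolution M p m fun n => fiberSum (ρ n) (S.freq μ n) where
  mem n := hR.fiberSum_mem le_rfl (S.isFreqUpTo_freq hμ n)
  close n := hR.l1_fiberSum_sub_le hm (S.freq_nonneg (n + 1)) (S.card_mul_sum_freq hμ (n + 1))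
    (S.freq_step hμ n)

/-- At level `n` both frequency vectors are almost determined by index sums close to the same `z`,
which bounds their scaled distance by `4 * (1/2)^n`. The exact equations make this distance
nondecreasing in the level, so it is zero at every level. -/
theorem Realizes.freq_eq_of_shadows (hR : S.Realizes p k M m ρ u) (hM : IsManaged p k M)
    (hp : ∀ n, 0 < p n) (hm : StrictMono m) {μ ν : ProbabilityMeasure S.subshift.carrier}
    (hμ : μ ∈ S.subshift.invariantMeasures) (hν : ν ∈ S.subshift.invariantMeasures)
    {z : ∀ n, Fin (k n) → ℝ} (h : Shadows p m (fun n => fiberSum (ρ n) (S.freq μ n)) z)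
    (h' : Shadows p m (fun n => fiberSum (ρ n) (S.freq ν n)) z) (r : ℕ) :
    S.freq μ r = S.freq ν r := by
  have hbound : ∀ n, p (m n) * l1 (S.freq μ n - S.freq ν n) ≤ 4 * (1 / 2 : ℝ) ^ n := by
    intro n
    have hle : m n ≤ m (n + 1) := hm.monotone (Nat.le_succ n)
    set w : (Fin (k (m (n + 1))) → ℝ) → S.L n → ℝ := fun c i => u n i * push M (m (n + 1)) c (m n) (ρ n i)
      with hw
    have e1 := hR.l1_freq_sub_le hm (S.freq_nonneg (n + 1)) (S.card_mul_sum_freq hμ (n + 1))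
      (S.freq_step hμ n)
    have e2 := hR.l1_freq_sub_le hm (S.freq_nonneg (n + 1)) (S.card_mul_sum_freq hν (n + 1))
      (S.freq_step hν n)
    set a := fiberSum (ρ (n + 1)) (S.freq μ (n + 1))
    set b := fiberSum (ρ (n + 1)) (S.freq ν (n + 1))
    have e3 : p (m n) * l1 (w a - w b) ≤ 2 * (1 / 2 : ℝ) ^ n := by
      have : w a - w b = fun i => u n i * push M (m (n + 1)) (a - b) (m n) (ρ n i) := by
        funext i
        simp only [hw, Pi.sub_apply, push_sub M hle]
        ring
      rw [this, l1_mul_comp _ (hR.u_nonneg n) (hR.u_sum n)]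
      refine (mul_l1_push_le hM hp hle _).trans ?_
      have t := mul_le_mul_of_nonneg_left (l1_sub_le a (z (m (n + 1))) b)
        (Nat.cast_nonneg (α := ℝ) (p (m (n + 1))))
      have t1 := h (n + 1)
      have t2 := h' (n + 1)
      rw [l1_sub_comm] at t2
      rw [mul_add] at t
      rw [pow_succ] at t1 t2
      linarith
    rw [l1_sub_comm] at e2
    have t := mul_le_mul_of_nonneg_left (l1_sub_le (S.freq μ n) (w a) (S.freq ν n))
      (Nat.cast_nonneg (α := ℝ) (p (m n)))
    have t' := mul_le_mul_of_nonneg_left (l1_sub_le (w a) (w b) (S.freq ν n))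
      (Nat.cast_nonneg (α := ℝ) (p (m n)))
    rw [mul_add] at t t'
    linarith
  have hcontr : ∀ n, p (m n) * l1 (S.freq μ n - S.freq ν n) ≤
      p (m (n + 1)) * l1 (S.freq μ (n + 1) - S.freq ν (n + 1)) := by
    intro n
    rw [← hR.card, ← hR.card, ← S.card_J_mul, Nat.cast_mul, mul_comm ((S.J n).card : ℝ), mul_assoc]
    refine mul_le_mul_of_nonneg_left ?_ (by positivity)
    have : ∀ j, ∑ i, (S.count n i j : ℝ) * |S.freq μ (n + 1) j - S.freq ν (n + 1) j| =
        (S.J n).card * |S.freq μ (n + 1) j - S.freq ν (n + 1) j| := fun j => by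
      rw [← Finset.sum_mul, ← Nat.cast_sum, S.sum_count]
    simp only [l1, Pi.sub_apply]
    rw [Finset.mul_sum, ← Finset.sum_congr rfl fun j _ => this j, Finset.sum_comm]
    refine Finset.sum_le_sum fun i _ => ?_
    rw [S.freq_step hμ, S.freq_step hν, ← Finset.sum_sub_distrib]
    refine (Finset.abs_sum_le_sum_abs _ _).trans_eq (Finset.sum_congr rfl fun j _ => ?_)
    rw [← mul_sub, abs_mul, Nat.abs_cast]
  have hmono := monotone_nat_of_le_succ hcontr
  have hlim : Tendsto (fun n : ℕ => 4 * (1 / 2 : ℝ) ^ n) atTop (𝓝 0) := by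
    simpa using (tendsto_pow_atTop_nhds_zero_of_lt_one (r := (1 / 2 : ℝ)) (by norm_num)
      (by norm_num)).const_mul 4
  have h0 : p (m r) * l1 (S.freq μ r - S.freq ν r) ≤ 0 := by
    refine ge_of_tendsto hlim ?_
    filter_upwards [eventually_ge_atTop r] with n hn
    exact (hmono hn).trans (hbound n)
  have hpr : (0 : ℝ) < p (m r) := by exact_mod_cast hp _
  exact eq_of_l1_le_zero (nonpos_of_mul_nonpos_right h0 hpr)

/-- At stage `n`, weight `z (m n) l` is spread over the translates of a point with a tile of index
`l` at the identity. A limit along an ultrafilter is invariant by the Følner property, and shadows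
`z` because clopen frequencies pass to the limit. -/
theorem Realizes.exists_shadowed (hR : S.Realizes p k M m ρ u) (hF : S.Folner) (hM : IsManaged p k M)
    (hp : ∀ n, 0 < p n) (hm : StrictMono m) {z : ∀ n, Fin (k n) → ℝ}
    (hz : z ∈ inverseLimit p k M) :
    ∃ μ ∈ S.subshift.invariantMeasures, Shadows p m (fun n => fiberSum (ρ n) (S.freq μ n)) z := by
  choose j hj x hx hxj using hR.exists_label
  have h1 : ∀ n, ((S.F n).card : ℝ) * ∑ l, z (m n) l = 1 := fun n => by
    rw [(hz.1 (m n)).2, hR.card, mul_one_div_cancel]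
    exact_mod_cast (hp _).ne'
  let μs : ℕ → ProbabilityMeasure S.subshift.carrier := fun n =>
    ⟨S.empirical n (z (m n)) fun l => ⟨x n l, hx n l⟩,
      S.isProbabilityMeasure_empirical (hz.1 (m n)).1 _ (h1 n)⟩
  have hμs : ∀ n, (μs n : Measure S.subshift.carrier) =
    S.empirical n (z (m n)) fun l => ⟨x n l, hx n l⟩ := fun n => rfl
  obtain ⟨μ, -, hμ⟩ := isCompact_univ.ultrafilter_le_nhds ((hyperfilter ℕ).map μs) (by simp)
  have hμ : Tendsto μs (hyperfilter ℕ) (𝓝 μ) := hμ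
  have hlim : ∀ A, IsClopen A → Tendsto (fun n => (μs n : Measure S.subshift.carrier).real A)
      (hyperfilter ℕ) (𝓝 ((μ : Measure S.subshift.carrier).real A)) := fun A hA =>
    ((Subshift.continuous_measureReal hA).tendsto μ).comp hμ
  have hat : (hyperfilter ℕ : Filter ℕ) ≤ atTop := Nat.hyperfilter_le_atTop
  refine ⟨μ, ?_, fun r => ?_⟩
  · rw [Subshift.mem_invariantMeasures_iff]
    intro g A hA
    have hr := (hlim A hA).add ((hF g⁻¹).mono_left hat)
    rw [add_zero] at hr
    refine le_of_tendsto_of_tendsto (hlim _ (hA.preimage (Subshift.continuous_shiftMap g))) hr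
      (Eventually.of_forall fun n => ?_)
    exact S.empirical_preimage_le (hz.1 (m n)).1 _ (h1 n) g hA
  · have hfreq : Tendsto (fun n => S.freq (μs n) r) (hyperfilter ℕ) (𝓝 (S.freq μ r)) :=
      tendsto_pi_nhds.2 fun i => hlim _ (S.isClopen_cyl r 1 i)
    have hcont : Continuous fun v : S.L r → ℝ => p (m r) * l1 (fiberSum (ρ r) v - z (m r)) :=
      continuous_const.mul (continuous_l1.comp ((continuous_fiberSum _).sub continuous_const))
    refine le_of_tendsto ((hcont.tendsto _).comp hfreq) (hat ?_)
    filter_upwards [eventually_ge_atTop r] with n hn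
    have hv := S.isFreqUpTo_empirical (hz.1 (m n)).1 (h1 n) (fun l => ⟨x n l, hx n l⟩)
      (j := j n) (hxj n)
    -- At its own level the empirical measure sees only the tiles at the identity, so its index sums
    -- are exact.
    have hzn : fiberSum (ρ n) (S.freq (μs n) n) = z (m n) := by
      classical
      funext l
      simp only [fiberSum, freq, hμs, S.empirical_cyl (hz.1 (m n)).1, S.occ_self (hx n _) (hxj n _)]
      rw [Finset.sum_comm]
      simp [hj]
    refine (hR.l1_fiberSum_sub_le_of_eq hM hp hm hv hz hzn hn).trans ?_
    have : (0 : ℝ) ≤ (1 / 2) ^ n := by positivity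
    linarith

/-- A continuous bijection from a compact space to a Hausdorff space. It is affine because
frequencies are affine in the measure and the shadowed solution is unique. -/
theorem Realizes.affinelyHomeomorphic (hR : S.Realizes p k M m ρ u) (hF : S.Folner)
    (hM : IsManaged p k M) (hp : ∀ n, 0 < p n) (hm : StrictMono m) :
    AffinelyHomeomorphic S.subshift.invariantMeasures (inverseLimit p k M) := by
  let b : ProbabilityMeasure S.subshift.carrier → ∀ n, Fin (k (m n)) → ℝ :=
    fun μ n => fiberSum (ρ n) (S.freq μ n)
  choose z hz hzs using fun μ : S.subshift.invariantMeasures =>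
    (hR.isApproxSolution hm μ.2).exists_shadows hM hp hm
  have hcont : Continuous z := by
    refine continuous_of_shadows hM hp hm (b := fun μ : S.subshift.invariantMeasures => b μ)
      (fun n => ?_) hz hzs
    refine (continuous_fiberSum (ρ n)).comp (continuous_pi fun i => ?_)
    exact (Subshift.continuous_measureReal (S.isClopen_cyl n 1 i)).comp continuous_subtype_val
  let φ : S.subshift.invariantMeasures → inverseLimit p k M := fun μ => ⟨z μ, hz μ⟩
  have hbij : Function.Bijective φ := by
    refine ⟨fun μ ν h => Subtype.ext ?_, fun y => ?_⟩
    · have hzz : z μ = z ν := congrArg Subtype.val h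
      refine S.measureReal_eq_of_freq_eq hF μ.2 ν.2 fun n j => ?_
      exact congrFun (hR.freq_eq_of_shadows hM hp hm μ.2 ν.2 (hzs μ) (hzz ▸ hzs ν) n) j
    · obtain ⟨μ, hμ, hs⟩ := hR.exists_shadowed hF hM hp hm y.2
      exact ⟨⟨μ, hμ⟩, Subtype.ext (Shadows.unique hM hp hm (hz _) y.2 (hzs ⟨μ, hμ⟩) hs)⟩
  have hφ : Continuous φ := hcont.subtype_mk _
  refine ⟨Continuous.homeoOfEquivCompactToT2 (f := Equiv.ofBijective φ hbij) hφ, ?_⟩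
  intro μ ν κ t h0 h1 h
  refine Shadows.unique hM hp hm (hz κ) (convex_combination_mem_inverseLimit (hz μ) (hz ν) h0 h1)
    (hzs κ) ?_
  have hs := (hzs μ).convex_combination (hzs ν) h0 h1
  refine (congrArg (fun b => Shadows p m b (t • z μ + (1 - t) • z ν)) ?_).mpr hs
  funext n l
  simp only [Pi.add_apply, Pi.smul_apply, smul_eq_mul, fiberSum, Finset.mul_sum,
    ← Finset.sum_add_distrib]
  refine Finset.sum_congr rfl fun i _ => ?_
  have hfin : ∀ s : ℝ, ∀ μ : ProbabilityMeasure S.subshift.carrier,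
      (ENNReal.ofReal s • (μ : Measure S.subshift.carrier)) (S.cyl n 1 i) ≠ ⊤ := fun s μ => by
    rw [Measure.smul_apply, smul_eq_mul]
    exact ENNReal.mul_ne_top ENNReal.ofReal_ne_top (measure_ne_top _ _)
  rw [freq, h, measureReal_add_apply (hfin _ _) (hfin _ _), measureReal_ennreal_smul_apply, measureReal_ennreal_smul_apply,
    ENNReal.toReal_ofReal h0, ENNReal.toReal_ofReal (by linarith)]
  rfl

end

end TileSystem

/-! ### Labelling the subtiles of a tile -/

section Rounding

theorem sum_card_fiber {α κ : Type*} [Fintype κ] (X : Finset α) (f : α → κ) [∀ l, DecidablePred fun d => f d = l] :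
    ∑ l, ((X.filter fun d => f d = l).card : ℝ) = X.card := by
  classical
  rw [← Nat.cast_sum, Finset.card_eq_sum_card_fiberwise (f := f) (t := Finset.univ) (by simp)]
  congr 1
  refine Finset.sum_congr rfl fun l _ => ?_
  congr

variable {α κ : Type*} [Fintype κ] [DecidableEq κ] [Nonempty κ]

theorem exists_le_card_fiber (X : Finset α) (n : κ → ℕ) (h : ∑ l, n l ≤ X.card) :
    ∃ lab : α → κ, ∀ l, n l ≤ (X.filter fun d => lab d = l).card := by
  classical
  have hcard : Fintype.card (Σ l, Fin (n l)) ≤ Fintype.card X := by simpa using h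
  obtain ⟨g⟩ := Function.Embedding.nonempty_of_card_le hcard
  let lab : α → κ := fun d =>
    if h : ∃ y, (g y : α) = d then h.choose.1 else Classical.arbitrary κ
  have hlab : ∀ y, lab (g y) = y.1 := by
    intro y
    have h : ∃ y', (g y' : α) = g y := ⟨y, rfl⟩
    simp only [lab, dif_pos h]
    rw [g.injective (Subtype.ext h.choose_spec)]
  refine ⟨lab, fun l => ?_⟩
  have : (Finset.univ.image fun a : Fin (n l) => (g ⟨l, a⟩ : α)) ⊆ X.filter fun d => lab d = l := by
    intro d hd
    obtain ⟨a, -, rfl⟩ := Finset.mem_image.1 hd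
    exact Finset.mem_filter.2 ⟨(g _).2, hlab _⟩
  refine le_trans ?_ (Finset.card_le_card this)
  rw [Finset.card_image_of_injective]
  · simp
  · intro a b hab
    simpa using g.injective (Subtype.ext hab)

/-- A finite set can be coloured with prescribed proportions, up to a bounded error. -/
theorem exists_rounding (X : Finset α) {π : κ → ℝ} (h0 : ∀ l, 0 ≤ π l) (h1 : ∑ l, π l = 1) :
    ∃ lab : α → κ, ∑ l, |((X.filter fun d => lab d = l).card : ℝ) - π l * X.card| ≤
      2 * Fintype.card κ := by
  have hfl : ∀ l, (⌊π l * X.card⌋₊ : ℝ) ≤ π l * X.card := fun l =>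
    Nat.floor_le (mul_nonneg (h0 l) (Nat.cast_nonneg _))
  have hsum : ∑ l, ⌊π l * X.card⌋₊ ≤ X.card := by
    have : ((∑ l, ⌊π l * X.card⌋₊ : ℕ) : ℝ) ≤ X.card := by
      push_cast
      refine (Finset.sum_le_sum fun l _ => hfl l).trans_eq ?_
      rw [← Finset.sum_mul, h1, one_mul]
    exact_mod_cast this
  obtain ⟨lab, hlab⟩ := exists_le_card_fiber X _ hsum
  refine ⟨lab, ?_⟩
  -- Each fibre has at least the floor of its target size, so the difference exceeds `-1`; its
  -- absolute value is at most itself plus `2`, and the differences sum to zero.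
  have hterm : ∀ l, |((X.filter fun d => lab d = l).card : ℝ) - π l * X.card| ≤
      ((X.filter fun d => lab d = l).card - π l * X.card) + 2 := by
    intro l
    have h2 : (⌊π l * X.card⌋₊ : ℝ) ≤ (X.filter fun d => lab d = l).card := by exact_mod_cast hlab l
    have h3 := Nat.lt_floor_add_one (π l * X.card)
    rw [abs_le]
    constructor <;> linarith
  refine (Finset.sum_le_sum fun l _ => hterm l).trans_eq ?_
  have hX : ∑ l, ((X.filter fun d => lab d = l).card : ℝ) = X.card := sum_card_fiber _ _
  rw [Finset.sum_add_distrib, Finset.sum_sub_distrib, hX, ← Finset.sum_mul, h1]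
  simp [mul_comm]

/-- A version of `exists_rounding` in each class of a partition. -/
theorem exists_rounding_classes {θ : Type*} [Fintype θ] [DecidableEq θ] (t : α → θ) (X : Finset α)
    {π : κ → ℝ} (h0 : ∀ l, 0 ≤ π l) (h1 : ∑ l, π l = 1) :
    ∃ lab : α → κ, ∑ q : κ × θ, |((X.filter fun d => (lab d, t d) = q).card : ℝ) -
      π q.1 * (X.filter fun d => t d = q.2).card| ≤ 2 * Fintype.card κ * Fintype.card θ := by
  choose lab hlab using fun s => exists_rounding (X.filter fun d => t d = s) h0 h1
  refine ⟨fun d => lab (t d) d, ?_⟩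
  rw [Fintype.sum_prod_type, Finset.sum_comm]
  refine (Finset.sum_le_sum fun s _ => ?_).trans
    (b := ∑ _s : θ, 2 * (Fintype.card κ : ℝ)) (by simp [mul_comm])
  refine le_trans (le_of_eq (Finset.sum_congr rfl fun l _ => ?_)) (hlab s)
  rw [Finset.filter_filter]
  congr 4
  ext d
  simp only [Finset.mem_filter, Prod.mk.injEq]
  constructor
  · rintro ⟨hd, h, rfl⟩; exact ⟨hd, rfl, h⟩
  · rintro ⟨hd, rfl, h⟩; exact ⟨hd, h, rfl⟩

end Rounding

/-! ### Labels with two colours, and the labelling of one level. -/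

/-- The labels of a tile: the root label, or a column with two colours. -/
abbrev Label (k : ℕ) (Q : Type u) : Type u := Option (Fin k × Q × Q)

namespace Label

variable {k : ℕ} {Q : Type u}

/-- The column of a label. -/
def column (hk : 0 < k) : Label k Q → Fin k
  | none => ⟨0, hk⟩
  | some a => a.1

/-- The first colour of a label. -/
def fst [One Q] : Label k Q → Q
  | none => 1
  | some a => a.2.1

/-- The second colour of a label. -/
def snd [One Q] : Label k Q → Q
  | none => 1
  | some a => a.2.2

/-- The label with equal colours. -/
def diag (a : Fin k × Q) : Label k Q := some (a.1, a.2, a.2)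

theorem diag_injective : Function.Injective (diag : Fin k × Q → Label k Q) := by
  rintro ⟨l, s⟩ ⟨l', s'⟩ h
  simp only [diag, Option.some.injEq, Prod.mk.injEq] at h
  rw [h.1, h.2.1]

end Label

section OneStep

open Label

/-- The distribution of labels on a set of positions of almost full measure is close to the
target distribution. -/
theorem sum_abs_count_sub_le {k : ℕ} (hk : 0 < k) {Q : Type u} [Fintype Q] [DecidableEq Q]
    {G : Type*} [DecidableEq G] {J I : Finset G} (hI : I ⊆ J) (hI0 : I.Nonempty) (t : G → Q) (c : Fin k → ℝ) (hc : ∀ l, 0 ≤ c l)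
    (hcJ : ∑ l, c l = J.card) (lab : G → Fin k) {C : ℝ}
    (hlab : ∑ q : Fin k × Q, |((I.filter fun d => (lab d, t d) = q).card : ℝ) -
      c q.1 / J.card * (I.filter fun d => t d = q.2).card| ≤ C)
    (w : G → Label k Q) (hw : ∀ d ∈ I, w d = diag (lab d, t d))
    (u : Label k Q → ℝ) (hu : ∀ q, u (diag q) = (I.filter fun d => t d = q.2).card / I.card)
    (hu0 : ∀ i, i ∉ Set.range (diag : Fin k × Q → Label k Q) → u i = 0) :
    ∑ i, |((J.filter fun d => w d = i).card : ℝ) - u i * c (column hk i)| ≤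
      C + 2 * (J \ I).card := by
  have hIpos : (0 : ℝ) < I.card := by exact_mod_cast hI0.card_pos
  have hJpos : (0 : ℝ) < J.card := by exact_mod_cast (hI0.mono hI).card_pos
  have hsplit : ∀ i, ((J.filter fun d => w d = i).card : ℝ) =
      (I.filter fun d => w d = i).card + ((J \ I).filter fun d => w d = i).card := by
    intro i
    rw [← Nat.cast_add, ← Finset.card_union_of_disjoint, ← Finset.filter_union,
      Finset.union_sdiff_of_subset hI]
    exact Finset.disjoint_filter_filter Finset.disjoint_sdiff
  have hA : ∑ i, (((J \ I).filter fun d => w d = i).card : ℝ) = (J \ I).card := sum_card_fiber _ _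
  have hzero : ∀ i, i ∉ Set.range (diag : Fin k × Q → Label k Q) →
      (I.filter fun d => w d = i).card = 0 := by
    intro i hi
    rw [Finset.card_eq_zero, Finset.filter_eq_empty_iff]
    intro d hd h
    exact hi ⟨_, (hw d hd).symm.trans h⟩
  have hB : ∑ i, |((I.filter fun d => w d = i).card : ℝ) - u i * c (column hk i)| ≤
      C + (J \ I).card := by
    rw [← Fintype.sum_of_injective diag diag_injective
      (fun q => |((I.filter fun d => (lab d, t d) = q).card : ℝ) -
        (I.filter fun d => t d = q.2).card / I.card * c q.1|)]
    -- The second term is the cost of normalizing by `I` instead of `J`; it sums to the size of `J \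
    -- I`.
    · calc _ ≤ ∑ q : Fin k × Q, (|((I.filter fun d => (lab d, t d) = q).card : ℝ) -
              c q.1 / J.card * (I.filter fun d => t d = q.2).card| +
              c q.1 * ((I.filter fun d => t d = q.2).card * (1 / I.card - 1 / J.card))) := by
            refine Finset.sum_le_sum fun q _ => ?_
            refine (abs_sub_le _ (c q.1 / J.card * (I.filter fun d => t d = q.2).card) _).trans ?_
            refine add_le_add le_rfl (le_of_eq ?_)
            rw [abs_sub_comm, abs_of_nonneg]
            · ring
            · have hle : (1 : ℝ) / J.card ≤ 1 / I.card :=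
                one_div_le_one_div_of_le hIpos (by exact_mod_cast Finset.card_le_card hI)
              have : 0 ≤ c q.1 * ((I.filter fun d => t d = q.2).card * (1 / I.card - 1 / J.card : ℝ)) :=
                mul_nonneg (hc _) (mul_nonneg (Nat.cast_nonneg _) (by linarith))
              refine this.trans_eq ?_
              ring
        _ ≤ _ := by
            rw [Finset.sum_add_distrib]
            refine add_le_add hlab (le_of_eq ?_)
            rw [Fintype.sum_prod_type]
            simp only [← Finset.mul_sum, ← Finset.sum_mul]
            have hIsum : ∑ s, ((I.filter fun d => t d = s).card : ℝ) = I.card := sum_card_fiber _ _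
            rw [hIsum, hcJ, Finset.card_sdiff_of_subset hI, Nat.cast_sub (Finset.card_le_card hI)]
            field_simp
    · intro i hi
      rw [hzero i hi, hu0 i hi]
      simp
    · intro q
      rw [hu]
      congr 3
      refine congrArg Finset.card (Finset.filter_congr fun d hd => ?_)
      rw [hw d hd, diag_injective.eq_iff]
  calc _ ≤ ∑ i, (|((I.filter fun d => w d = i).card : ℝ) - u i * c (column hk i)| +
        ((J \ I).filter fun d => w d = i).card) := by
        refine Finset.sum_le_sum fun i _ => ?_
        rw [hsplit, add_sub_right_comm]
        exact (abs_add_le _ _).trans_eq (by rw [Nat.abs_cast])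
    _ ≤ _ := by
        rw [Finset.sum_add_distrib, hA]
        linarith

open scoped Classical in
-- All but a few positions lie in `I`: they are interior, so both colours equal the coset of the
-- position. There the indices are rounded within each coset class, which makes index and colour
-- independent and gives weights `u` that are the same for all parents. The remaining positions are
-- the boundary, the identity and the code; `hsize` absorbs them and the rounding error.
theorem exists_labelling {G : Type u} [Group G] {Γ : Subgroup G} [Γ.Normal] [Fintype (G ⧸ Γ)] {k k' : ℕ} (hk : 2 ≤ k)
    {A B J : Finset G} (h1J : 1 ∈ J) {E E' : Set G} (hE1 : ∀ f ∈ A, ∀ a ∈ E', 1 * f * a ∈ B)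
    (hEE : E ⊆ E')
    (c : Fin k' → Fin k → ℝ) (hk' : 0 < k') (hc : ∀ l' l, 0 ≤ c l' l)
    (hcJ : ∀ l', ∑ l, c l' l = J.card) {δ : ℝ} (hδ : δ ≤ 1)
    (hsize : 2 * k * (Fintype.card (G ⧸ Γ) : ℝ) +
      2 * ((J.filter fun d => ¬ ∀ f ∈ A, ∀ a ∈ E', d * f * a ∈ B).card + 1 +
        Fintype.card (Label k' (G ⧸ Γ)) + k) ≤ δ * J.card) :
    ∃ (w : Label k' (G ⧸ Γ) → G → Label k (G ⧸ Γ)) (u : Label k (G ⧸ Γ) → ℝ),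
      (∀ j, ∀ d ∈ J, (w j d = none ↔ d = 1)) ∧
      (∀ j j', (∀ d ∈ J, w j d = w j' d) → j = j') ∧
      (∀ j, ∀ d ∈ J, ((∀ f ∈ A, ∀ a ∈ E, d * f * a ∈ B) → (w j d).fst = (d : G ⧸ Γ)) ∧
        ((¬ ∀ f ∈ A, ∀ a ∈ E, d * f * a ∈ B) → (w j d).fst = j.fst * (d : G ⧸ Γ))) ∧
      (∀ j, ∀ d ∈ J, ((∀ f ∈ A, ∀ a ∈ E', d * f * a ∈ B) → (w j d).snd = (d : G ⧸ Γ)) ∧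
        ((¬ ∀ f ∈ A, ∀ a ∈ E', d * f * a ∈ B) → (w j d).snd = j.snd * (d : G ⧸ Γ))) ∧
      (∀ i, 0 ≤ u i) ∧ (∀ l, fiberSum (column (by omega)) u l = 1) ∧
      (∀ j, ∑ i, |((J.filter fun d => w j d = i).card : ℝ) -
        u i * c (column hk' j) (column (by omega) i)| ≤ δ * J.card) ∧
      (∀ l, ∃ d ∈ J, column (by omega) (w none d) = l) := by
  have hk0 : 0 < k := by omega
  have : Nonempty (Fin k) := ⟨⟨0, hk0⟩⟩
  set bd := J.filter fun d => ¬ ∀ f ∈ A, ∀ a ∈ E', d * f * a ∈ B with hbd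
  have hsum0 : (0 : ℝ) ≤ 2 * k * (Fintype.card (G ⧸ Γ) : ℝ) := by positivity
  have hJle : δ * J.card ≤ J.card := mul_le_of_le_one_left (Nat.cast_nonneg _) hδ
  -- positions of the code
  have hemb : Fintype.card (Label k' (G ⧸ Γ) ⊕ Fin k) ≤ Fintype.card (J.erase 1 : Finset G) := by
    rw [Fintype.card_coe, Finset.card_erase_of_mem h1J, Fintype.card_sum, Fintype.card_fin]
    refine Nat.le_sub_one_of_lt ?_
    have : ((Fintype.card (Label k' (G ⧸ Γ)) + k : ℕ) : ℝ) < J.card := by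
      have h0 : (0 : ℝ) ≤ bd.card := Nat.cast_nonneg _
      have h2 : (0 : ℝ) ≤ Fintype.card (Label k' (G ⧸ Γ)) := Nat.cast_nonneg _
      have h3 : (0 : ℝ) ≤ k := Nat.cast_nonneg _
      push_cast only [Nat.cast_add]
      linarith
    exact_mod_cast this
  obtain ⟨e⟩ := Function.Embedding.nonempty_of_card_le hemb
  have he : ∀ y, (e y : G) ∈ J ∧ (e y : G) ≠ 1 := fun y =>
    ⟨Finset.mem_of_mem_erase (e y).2, Finset.ne_of_mem_erase (e y).2⟩
  set bad := bd ∪ ({1} ∪ Finset.univ.image fun y => (e y : G)) with hbad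
  have hbadcard : (bad.card : ℝ) ≤ bd.card + 1 + Fintype.card (Label k' (G ⧸ Γ)) + k := by
    have h1 := Finset.card_union_le bd ({1} ∪ Finset.univ.image fun y => (e y : G))
    have h2 := Finset.card_union_le {1} (Finset.univ.image fun y => (e y : G))
    have h3 : (Finset.univ.image fun y => (e y : G)).card ≤ _ := Finset.card_image_le
    rw [Finset.card_univ, Fintype.card_sum, Fintype.card_fin] at h3
    rw [Finset.card_singleton] at h2
    rw [← hbad] at h1
    have : bad.card ≤ bd.card + 1 + Fintype.card (Label k' (G ⧸ Γ)) + k := by omega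
    exact_mod_cast this
  set I := J \ bad with hI
  have hIJ : I ⊆ J := Finset.sdiff_subset
  have hJI : ((J \ I).card : ℝ) ≤ bad.card := by
    have : J \ I ⊆ bad := by
      intro d hd
      simp only [hI, Finset.mem_sdiff, not_and, not_not] at hd
      exact hd.2 hd.1
    exact_mod_cast Finset.card_le_card this
  have hbadpos : (0 : ℝ) < bad.card := by
    have : 0 < bad.card := Finset.card_pos.2 ⟨1, by simp [hbad]⟩
    exact_mod_cast this
  have hJpos : (0 : ℝ) < J.card := by exact_mod_cast Finset.card_pos.2 ⟨1, h1J⟩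
  have hI0 : I.Nonempty := by
    rw [Finset.nonempty_iff_ne_empty]
    intro h0
    rw [h0, Finset.sdiff_empty] at hJI
    linarith
  have hIpos : (0 : ℝ) < I.card := by exact_mod_cast hI0.card_pos
  choose rlab hrlab using fun l' : Fin k' => exists_rounding_classes (fun d : G => (d : G ⧸ Γ)) I
    (π := fun l => c l' l / J.card) (fun l => div_nonneg (hc l' l) hJpos.le)
    (by rw [← Finset.sum_div, hcJ, div_self hJpos.ne'])
  -- Code positions `inl j'` have index 1 exactly when the parent label is `j'`, which makes `w`
  -- injective (`2 ≤ k` is used here); code positions `inr l` have index `l`, so every index occurs.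
  let lab : Label k' (G ⧸ Γ) → G → Fin k := fun j d =>
    if h : ∃ y, (e y : G) = d then
      Sum.elim (fun j' => if j = j' then ⟨1, by omega⟩ else ⟨0, hk0⟩) id h.choose
    else rlab (column hk' j) d
  have hlab : ∀ j y, lab j (e y) =
      Sum.elim (fun j' => if j = j' then ⟨1, by omega⟩ else ⟨0, hk0⟩) id y := by
    intro j y
    have h : ∃ y', (e y' : G) = e y := ⟨y, rfl⟩
    simp only [lab, dif_pos h]
    rw [e.injective (Subtype.ext h.choose_spec)]
  let col : Set G → G ⧸ Γ → G → G ⧸ Γ := fun E s d =>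
    if ∀ f ∈ A, ∀ a ∈ E, d * f * a ∈ B then (d : G ⧸ Γ) else s * d
  let w : Label k' (G ⧸ Γ) → G → Label k (G ⧸ Γ) := fun j d =>
    if d = 1 then none else some (lab j d, col E j.fst d, col E' j.snd d)
  have hw : ∀ j d, d ≠ 1 → w j d = some (lab j d, col E j.fst d, col E' j.snd d) := fun j d hd =>
    if_neg hd
  have hw1 : ∀ j, w j 1 = none := fun j => if_pos rfl
  let u : Label k (G ⧸ Γ) → ℝ := fun i =>
    if i ∈ Set.range (diag : Fin k × (G ⧸ Γ) → Label k (G ⧸ Γ)) then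
      (I.filter fun d : G => (d : G ⧸ Γ) = i.fst).card / I.card else 0
  have hu : ∀ q, u (diag q) = (I.filter fun d : G => (d : G ⧸ Γ) = q.2).card / I.card := fun q =>
    if_pos ⟨q, rfl⟩
  have hu0 : ∀ i, i ∉ Set.range (diag : Fin k × (G ⧸ Γ) → Label k (G ⧸ Γ)) → u i = 0 := fun i hi =>
    if_neg hi
  refine ⟨w, u, fun j d _ => ?_, fun j j' h => ?_, fun j d _ => ?_, fun j d _ => ?_, fun i => ?_,
    fun l => ?_, fun j => ?_, fun l => ?_⟩
  · by_cases hd : d = 1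
    · simp [hd, hw1]
    · simp [hw j d hd, hd]
  · by_contra hne
    have h2 := h _ (he (Sum.inl j)).1
    rw [hw _ _ (he _).2, hw _ _ (he _).2] at h2
    have h3 := congrArg Prod.fst (Option.some.inj h2)
    simp only [hlab, Sum.elim_inl, if_true, if_neg (Ne.symm hne), Fin.mk.injEq] at h3
    exact absurd h3 (by norm_num)
  · by_cases hd : d = 1
    · subst hd
      -- The root label has trivial colour, as the law requires only because the identity subtile is
      -- interior.
      refine ⟨fun _ => by simp [hw1, Label.fst], fun h => absurd (fun f hf a ha => ?_) h⟩
      exact hE1 f hf a (hEE ha)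
    · rw [hw j d hd]
      exact ⟨fun h => if_pos h, fun h => if_neg h⟩
  · by_cases hd : d = 1
    · subst hd
      exact ⟨fun _ => by simp [hw1, Label.snd], fun h => absurd hE1 h⟩
    · rw [hw j d hd]
      exact ⟨fun h => if_pos h, fun h => if_neg h⟩
  · simp only [u]
    split_ifs
    · positivity
    · exact le_rfl
  · have hIsum : ∑ s : G ⧸ Γ, ((I.filter fun d : G => (d : G ⧸ Γ) = s).card : ℝ) = I.card := sum_card_fiber _ _
    rw [fiberSum, Finset.sum_filter, ← Fintype.sum_of_injective diag diag_injective
      (fun q => if q.1 = l then ((I.filter fun d : G => (d : G ⧸ Γ) = q.2).card : ℝ) / I.card else 0)]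
    · rw [Fintype.sum_prod_type]
      simp only [Finset.sum_ite_irrel, Finset.sum_const_zero, Finset.sum_ite_eq', Finset.mem_univ,
        if_true]
      rw [← Finset.sum_div, hIsum, div_self hIpos.ne']
    · intro i hi
      simp [hu0 i hi]
    · intro q
      rw [hu]
      rfl
  · have hr : ∑ q : Fin k × (G ⧸ Γ),
        |((I.filter fun d : G => (rlab (column hk' j) d, (d : G ⧸ Γ)) = q).card : ℝ) -
          c (column hk' j) q.1 / J.card * (I.filter fun d : G => (d : G ⧸ Γ) = q.2).card| ≤
        2 * k * Fintype.card (G ⧸ Γ) := by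
      have := hrlab (column hk' j)
      rw [Fintype.card_fin] at this
      convert this
    have key := sum_abs_count_sub_le hk0 hIJ hI0 (fun d : G => (d : G ⧸ Γ)) (c (column hk' j))
      (hc _) (hcJ _) (rlab (column hk' j)) hr (w j) (fun d hd => ?_) u hu hu0
    · refine key.trans ?_
      linarith
    · simp only [hI, hbad, hbd, Finset.mem_sdiff, Finset.mem_union, Finset.mem_filter, not_or,
        not_and, not_not, Finset.mem_singleton, Finset.mem_image, Finset.mem_univ, true_and,
        not_exists] at hd
      obtain ⟨hdJ, hdbd, hd1, hde⟩ := hd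
      have hint := hdbd hdJ
      rw [hw j d hd1]
      simp only [lab, col, dif_neg (not_exists.2 hde), if_pos hint,
        if_pos (show ∀ f ∈ A, ∀ a ∈ E, d * f * a ∈ B from fun f hf a ha => hint f hf a (hEE ha))]
      rfl
  · refine ⟨e (Sum.inr l), (he _).1, ?_⟩
    rw [hw _ _ (he _).2, hlab]
    rfl

end OneStep

/-! ### Telescoping congruent sequences -/

section Telescoping

variable {G : Type u} [Group G]

/-- The translates `d A`, `d ∈ J`, partition `B`, and `1 ∈ J`. -/
structure IsSubtiling (A B J : Finset G) : Prop where
  one_mem : 1 ∈ J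
  mul_mem : ∀ d ∈ J, ∀ f ∈ A, d * f ∈ B
  exists_mul : ∀ h ∈ B, ∃ d ∈ J, d⁻¹ * h ∈ A
  mul_inj : ∀ d ∈ J, ∀ d' ∈ J, ∀ h, d⁻¹ * h ∈ A → d'⁻¹ * h ∈ A → d = d'

theorem IsSubtiling.trans {A B C J J' : Finset G} (h : IsSubtiling A B J) (h' : IsSubtiling B C J') :
    ∃ J'', IsSubtiling A C J'' := by
  classical
  refine ⟨J' * J, ⟨1, h'.one_mem, 1, h.one_mem, by simp⟩ |> Finset.mem_mul.2, ?_, ?_, ?_⟩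
  · intro d hd f hf
    obtain ⟨a, ha, b, hb, rfl⟩ := Finset.mem_mul.1 hd
    rw [mul_assoc]
    exact h'.mul_mem a ha _ (h.mul_mem b hb f hf)
  · intro c hc
    obtain ⟨a, ha, hac⟩ := h'.exists_mul c hc
    obtain ⟨b, hb, hbc⟩ := h.exists_mul _ hac
    exact ⟨a * b, Finset.mul_mem_mul ha hb, by simpa [mul_assoc] using hbc⟩
  · intro d hd d' hd' c hc hc'
    obtain ⟨a, ha, b, hb, rfl⟩ := Finset.mem_mul.1 hd
    obtain ⟨a', ha', b', hb', rfl⟩ := Finset.mem_mul.1 hd'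
    obtain rfl : a = a' := h'.mul_inj a ha a' ha' c (by simpa [mul_assoc] using h.mul_mem b hb _ hc)
      (by simpa [mul_assoc] using h.mul_mem b' hb' _ hc')
    rw [h.mul_inj b hb b' hb' (a⁻¹ * c) (by simpa [mul_assoc] using hc)
      (by simpa [mul_assoc] using hc')]

theorem IsSubtiling.card_mul {A B J : Finset G} (h : IsSubtiling A B J) :
    J.card * A.card = B.card := by
  rw [← Finset.card_product]
  refine Finset.card_nbij (fun p => p.1 * p.2) ?_ ?_ ?_
  · rintro ⟨d, f⟩ hdf
    simp only [Finset.coe_product, Set.mem_prod, Finset.mem_coe] at hdf ⊢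
    exact h.mul_mem d hdf.1 f hdf.2
  · rintro ⟨d, f⟩ hdf ⟨d', f'⟩ hdf' heq
    simp only [Finset.coe_product, Set.mem_prod, Finset.mem_coe] at hdf hdf' heq
    obtain rfl := h.mul_inj d hdf.1 d' hdf'.1 (d * f) (by simpa using hdf.2)
      (by simpa [heq] using hdf'.2)
    simpa using heq
  · intro b hb
    obtain ⟨d, hd, hdb⟩ := h.exists_mul b hb
    exact ⟨(d, d⁻¹ * b), by simp [hd, hdb], by simp⟩

variable {F : ℕ → Finset G}

theorem IsCongruentSeq.one_mem (h : IsCongruentSeq F) (n : ℕ) : 1 ∈ F n := by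
  induction n with
  | zero => exact h.1
  | succ n ih =>
    obtain ⟨J, h1, hJ⟩ := h.2 n
    have : (1 : G) ∈ (F (n + 1) : Set G) := by
      rw [← hJ.2]
      exact Set.mem_biUnion h1 ⟨1, ih, by simp⟩
    exact this

theorem IsCongruentSeq.exists_isSubtiling (h : IsCongruentSeq F) {n N : ℕ} (hn : n ≤ N) :
    ∃ J, IsSubtiling (F n) (F N) J := by
  induction N, hn using Nat.le_induction with
  | base => exact ⟨{1}, by simp, by simp, by simp, by simp⟩
  | succ N hN ih =>
    obtain ⟨J, hJ⟩ := ih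
    refine Exists.elim ?_ fun J' hJ' => hJ.trans (J' := J') (C := F (N + 1)) hJ'
    obtain ⟨T, h1, hT, hU⟩ := h.2 N
    have hmul : ∀ d ∈ T, ∀ f ∈ F N, d * f ∈ F (N + 1) := by
      intro d hd f hf
      have : d * f ∈ (F (N + 1) : Set G) := by
        rw [← hU]
        exact Set.mem_biUnion hd ⟨f, hf, rfl⟩
      exact this
    have hfin : T.Finite := (F (N + 1)).finite_toSet.subset fun d hd => by
      simpa using hmul d hd 1 (h.one_mem N)
    refine ⟨hfin.toFinset, by simpa using h1, fun d hd => hmul d (by simpa using hd), ?_, ?_⟩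
    · intro b hb
      have hb' : b ∈ (F (N + 1) : Set G) := hb
      rw [← hU] at hb'
      obtain ⟨d, hd, f, hf, rfl⟩ := Set.mem_iUnion₂.1 hb'
      exact ⟨d, by simpa using hd, by simpa using hf⟩
    · intro d hd d' hd' b hb hb'
      by_contra hne
      have hdis := hT (by simpa using hd) (by simpa using hd') hne
      exact Set.disjoint_left.1 hdis (Set.mem_smul_set_iff_inv_smul_mem.2 hb)
        (Set.mem_smul_set_iff_inv_smul_mem.2 hb')

theorem IsCongruentSeq.mono (h : IsCongruentSeq F) : Monotone F := by
  intro n N hn f hf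
  obtain ⟨J, hJ⟩ := h.exists_isSubtiling hn
  simpa using hJ.mul_mem 1 hJ.one_mem f hf

theorem IsCongruentMonotileSeq.exists_subset (h : IsCongruentMonotileSeq F) {E : Set G}
    (hE : E.Finite) : ∀ᶠ n in atTop, E ⊆ F n := by
  have : ∀ g ∈ E, ∀ᶠ n in atTop, g ∈ F n := by
    intro g _
    have hg : g ∈ ⋃ n, (F n : Set G) := by rw [h.exhaustive]; trivial
    obtain ⟨n, hn⟩ := Set.mem_iUnion.1 hg
    filter_upwards [eventually_ge_atTop n] with m hm
    exact h.congruent.mono hm hn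
  exact (hE.eventually_all).2 this

theorem IsCongruentMonotileSeq.tendsto_card [Infinite G] (h : IsCongruentMonotileSeq F) :
    Tendsto (fun n => ((F n).card : ℝ)) atTop atTop := by
  refine tendsto_natCast_atTop_atTop.comp (tendsto_atTop.2 fun b => ?_)
  obtain ⟨E, hE⟩ := Infinite.exists_subset_card_eq G b
  filter_upwards [h.exists_subset E.finite_toSet] with n hn
  rw [← hE]
  exact Finset.card_le_card (by exact_mod_cast hn)

theorem IsRightFolner.tendsto_ncard (h : IsRightFolner F) (g : G) : Tendsto
    (fun n => ((F n : Set G) ∩ {f | f * g ∉ F n}).ncard / ((F n).card : ℝ)) atTop (𝓝 0) := by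
  refine (h g).congr fun n => ?_
  congr 2
  rw [← Set.ncard_image_of_injective ((F n : Set G) ∩ {f | f * g ∉ F n}) (mul_left_injective g)]
  congr 1
  ext b
  constructor
  · rintro ⟨⟨f, hf, rfl⟩, hb⟩
    exact ⟨f, ⟨hf, hb⟩, rfl⟩
  · rintro ⟨f, ⟨hf, hb⟩, rfl⟩
    exact ⟨⟨f, hf, rfl⟩, hb⟩

theorem exists_strictMono_of_eventually {P : ℕ → ℕ → ℕ → Prop}
    (h : ∀ i n, ∀ᶠ N in atTop, P i n N) : ∃ m : ℕ → ℕ, StrictMono m ∧ ∀ i, P i (m i) (m (i + 1)) := by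
  choose next hnext using fun i n => ((h i n).and (eventually_gt_atTop n)).exists
  let m : ℕ → ℕ := fun i => Nat.rec 0 (fun i n => next i n) i
  exact ⟨m, strictMono_nat_of_lt_succ fun i => (hnext i (m i)).2, fun i => (hnext i (m i)).1⟩

open scoped Classical in
/-- In large tiles, few subtiles are close to the boundary, and there are few labels. -/
theorem IsCongruentMonotileSeq.eventually_card_le [Infinite G] (hF : IsCongruentMonotileSeq F)
    {k : ℕ → ℕ} {K : ℝ}
    (hk : ∀ n, (k (n + 1) : ℝ) ≤ K * (((F (n + 1)).card : ℝ) / ((F n).card : ℝ)))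
    (Q : Type u) [Fintype Q] (n : ℕ) {E : Set G} (hE : E.Finite) {δ : ℝ} (hδ : 0 < δ) :
    ∀ᶠ N in atTop, n ≤ N ∧ (∀ f ∈ F n, ∀ a ∈ E, 1 * f * a ∈ F N) ∧
      ∀ J, IsSubtiling (F n) (F N) J → 2 * (k n) * (Fintype.card Q : ℝ) +
        2 * ((J.filter fun d => ¬ ∀ f ∈ F n, ∀ a ∈ E, d * f * a ∈ F N).card + 1 +
          Fintype.card (Label (k N) Q) + k n) ≤ δ * J.card := by
  have hpos : ∀ n, (0 : ℝ) < (F n).card := fun n => by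
    exact_mod_cast Finset.card_pos.2 ⟨1, hF.congruent.one_mem n⟩
  set H : Finset G := ((F n).finite_toSet.mul hE).toFinset with hH
  set q : ℝ := (Fintype.card Q : ℝ) with hq
  -- In `2 + k n`, one unit is the identity position and the other the root label in the count of
  -- labels of level `N`.
  set c : ℝ := 2 * k n * q + 2 * (2 + k n)
  have hinv : Tendsto (fun N => ((F N).card : ℝ)⁻¹) atTop (𝓝 0) :=
    tendsto_inv_atTop_zero.comp hF.tendsto_card
  have hkN : Tendsto (fun N => (k N : ℝ) * ((F N).card : ℝ)⁻¹) atTop (𝓝 0) := by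
    -- The growth bound gives `k (N + 1) / |F (N + 1)| ≤ K / |F N|`, which tends to zero.
    rw [← tendsto_add_atTop_iff_nat 1]
    refine squeeze_zero (g := fun N => K * ((F N).card : ℝ)⁻¹) (fun N => by positivity) (fun N => ?_)
      (by simpa using hinv.const_mul K)
    rw [← div_eq_mul_inv, div_le_iff₀ (hpos _)]
    refine (hk N).trans_eq ?_
    rw [div_eq_mul_inv]; ring
  have hlim : Tendsto (fun N => (F n).card * (c * ((F N).card : ℝ)⁻¹ +
      2 * (∑ h ∈ H, ((F N : Set G) ∩ {f | f * h ∉ F N}).ncard / ((F N).card : ℝ)) +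
      2 * (q * q) * ((k N : ℝ) * ((F N).card : ℝ)⁻¹))) atTop (𝓝 0) := by
    have h2 : Tendsto (fun N => ∑ h ∈ H, ((F N : Set G) ∩ {f | f * h ∉ F N}).ncard /
        ((F N).card : ℝ)) atTop (𝓝 0) := by
      simpa using tendsto_finsetSum H fun h _ => hF.folner.tendsto_ncard h
    simpa using (((hinv.const_mul c).add (h2.const_mul 2)).add
      (hkN.const_mul (2 * (q * q)))).const_mul ((F n).card : ℝ)
  have hHN : ∀ᶠ N in atTop, (H : Set G) ⊆ F N := hF.exists_subset H.finite_toSet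
  filter_upwards [eventually_ge_atTop n, hHN, hlim.eventually (gt_mem_nhds hδ)] with N hnN hN hlt
  refine ⟨hnN, fun f hf a ha => ?_, fun J hJ => ?_⟩
  · rw [one_mul]
    exact hN (by simpa [hH] using Set.mul_mem_mul (Finset.mem_coe.2 hf) ha)
  · have hbd : ((J.filter fun d => ¬ ∀ f ∈ F n, ∀ a ∈ E, d * f * a ∈ F N).card : ℝ) ≤
        ∑ h ∈ H, (((F N : Set G) ∩ {f | f * h ∉ F N}).ncard : ℝ) := by
      rw [← Set.ncard_coe_finset, ← Nat.cast_sum, Nat.cast_le]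
      refine le_trans (Set.ncard_le_ncard (t := ⋃ h ∈ H, (F N : Set G) ∩ {f | f * h ∉ F N}) ?_ ?_)
        (Finset.set_ncard_biUnion_le _ _)
      · intro d hd
        simp only [Finset.coe_filter, Set.mem_ofPred_eq, not_forall] at hd
        obtain ⟨hd, f, hf, a, ha, hda⟩ := hd
        refine Set.mem_biUnion (x := f * a) ?_ ⟨?_, ?_⟩
        · simpa [hH] using Set.mul_mem_mul (Finset.mem_coe.2 hf) ha
        · simpa using hJ.mul_mem d hd 1 (hF.congruent.one_mem n)
        · simpa [mul_assoc] using hda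
      · exact H.finite_toSet.biUnion fun h _ => (F N).finite_toSet.inter_of_left _
    have hcardL : (Fintype.card (Label (k N) Q) : ℝ) = k N * (q * q) + 1 := by
      simp [Label, q]
    have hJc : (J.card : ℝ) * (F n).card = (F N).card := by exact_mod_cast hJ.card_mul
    have hlt' := mul_lt_mul_of_pos_right hlt (hpos N)
    rw [← Finset.sum_div] at hlt'
    have hN0 := (hpos N).ne'
    set bd := ∑ h ∈ H, (((F N : Set G) ∩ {f | f * h ∉ F N}).ncard : ℝ)
    have e : ((F n).card : ℝ) * (c * ((F N).card : ℝ)⁻¹ + 2 * (bd / ((F N).card : ℝ)) +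
        2 * (q * q) * ((k N : ℝ) * ((F N).card : ℝ)⁻¹)) * (F N).card =
        (F n).card * (c + 2 * bd + 2 * (q * q) * k N) := by
      field_simp
    rw [e, ← hJc] at hlt'
    have : c + 2 * bd + 2 * (q * q) * k N < δ * J.card := by
      refine lt_of_mul_lt_mul_right (a := ((F n).card : ℝ)) ?_ (hpos n).le
      linarith
    rw [hcardL]
    simp only [c] at this
    linarith

end Telescoping

/-! ### Assembling the tile system and the conclusion. -/

open scoped Classical in
theorem exists_tileSystem {G : Type u} [Group G] [Infinite G] {F : ℕ → Finset G}
    (hF : IsCongruentMonotileSeq F) {k : ℕ → ℕ}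
    {M : ∀ n, Matrix (Fin (k n)) (Fin (k (n + 1))) ℕ} (hM : IsManaged (fun n => (F n).card) k M)
    {K : ℝ} (hk : ∀ n, (k (n + 1) : ℝ) ≤ K * (((F (n + 1)).card : ℝ) / ((F n).card : ℝ)))
    (Γ : Subgroup G) [Γ.Normal] [Γ.FiniteIndex] :
    ∃ (S : TileSystem G) (m : ℕ → ℕ) (ρ : ∀ n, S.L n → Fin (k (m n))) (u : ∀ n, S.L n → ℝ),
      StrictMono m ∧ S.Realizes (fun n => (F n).card) k M m ρ u ∧ S.Folner ∧
      ∃ (E E' : ℕ → Set G) (col col' : ∀ n, S.L n → G ⧸ Γ), S.ColorLaw Γ E col ∧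
        S.ColorLaw Γ E' col' ∧ (∀ n, E n = (S.F n : Set G) * (S.F n : Set G)⁻¹) ∧
        ∀ n, E n * (S.F n : Set G)⁻¹ * (S.F n : Set G) * E n ⊆ E' n := by
  have : Fintype (G ⧸ Γ) := Fintype.ofFinite _
  let E : ℕ → Set G := fun n => (F n : Set G) * (F n : Set G)⁻¹
  let E' : ℕ → Set G := fun n => E n * (F n : Set G)⁻¹ * (F n : Set G) * E n
  have hfin : ∀ n, (F n : Set G).Finite := fun n => (F n).finite_toSet
  have hE : ∀ n, (E n).Finite := fun n => (hfin n).mul (hfin n).inv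
  have hE' : ∀ n, (E' n).Finite := fun n => (((hE n).mul (hfin n).inv).mul (hfin n)).mul (hE n)
  have hEE : ∀ n, E n ⊆ E' n := fun n a ha => by
    have h1 : (1 : G) ∈ (F n : Set G) := hF.congruent.one_mem n
    have h2 : (1 : G) ∈ (F n : Set G)⁻¹ := by simpa using h1
    have h3 : (1 : G) ∈ E n := ⟨1, h1, 1, h2, by simp⟩
    exact ⟨1, ⟨1, ⟨1, h3, 1, h2, by simp⟩, 1, h1, by simp⟩, a, ha, by simp⟩
  have hp : ∀ n, 0 < (F n).card := fun n => Finset.card_pos.2 ⟨1, hF.congruent.one_mem n⟩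
  obtain ⟨m, hm, hgood⟩ := exists_strictMono_of_eventually fun i n =>
    hF.eventually_card_le hk (G ⧸ Γ) n (hE' n) (δ := (1 / 2 : ℝ) ^ i) (by positivity)
  have hmle : ∀ i, m i ≤ m (i + 1) := fun i => hm.monotone (Nat.le_succ i)
  choose J hJ using fun i => hF.congruent.exists_isSubtiling (hmle i)
  have hkpos : ∀ n, 0 < k n := fun n => by have := hM.two_le n; omega
  have hsum : ∀ i l', ∑ l, push M (m (i + 1)) (Pi.single l' 1) (m i) l = (J i).card := by
    intro i l'
    have h1 := mul_sum_push hM hp (hmle i) (Pi.single l' 1)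
    rw [Finset.sum_pi_single', if_pos (Finset.mem_univ _), mul_one, ← (hJ i).card_mul] at h1
    push_cast at h1
    have : (0 : ℝ) < (F (m i)).card := by exact_mod_cast hp (m i)
    refine mul_left_cancel₀ this.ne' (h1.trans (mul_comm _ _))
  choose w u hw hinj hc1 hc2 hu0 hu1 hclose hall using fun i =>
    exists_labelling (Γ := Γ) (hM.two_le (m i)) (hJ i).one_mem (hgood i).2.1 (hEE (m i))
      (fun l' l => push M (m (i + 1)) (Pi.single l' 1) (m i) l) (hkpos (m (i + 1)))
      (fun l' => push_nonneg (hmle i) fun l => by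
        by_cases h : l = l'
        · subst h; simp
        · simp [h])
      (hsum i) (pow_le_one₀ (by norm_num) (by norm_num)) ((hgood i).2.2 (J i) (hJ i))
  let en := Fintype.equivFin (Label (k (m 0)) (G ⧸ Γ) × F (m 0))
  let S : TileSystem G :=
    { F := fun i => F (m i)
      J := J
      L := fun i => Label (k (m i)) (G ⧸ Γ)
      fin := fun i => inferInstance
      w := w
      root := fun i => none
      alph := Fintype.card (Label (k (m 0)) (G ⧸ Γ) × F (m 0))
      -- A letter records the label and the position in the tile of level 0; outside the tile the
      -- position `1` is a default value.
      enc := fun j f => en (j, if h : f ∈ F (m 0) then ⟨f, h⟩ else ⟨1, hF.congruent.one_mem _⟩)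
      one_mem_F_zero := hF.congruent.one_mem _
      one_mem_J := fun i => (hJ i).one_mem
      mul_mem := fun i => (hJ i).mul_mem
      exists_mul := fun i => (hJ i).exists_mul
      mul_inj := fun i => (hJ i).mul_inj
      exhaust := fun g => by
        have hg : g ∈ ⋃ n, (F n : Set G) := by rw [hF.exhaustive]; trivial
        obtain ⟨n, hn⟩ := Set.mem_iUnion.1 hg
        exact ⟨n, hF.congruent.mono (hm.id_le n) hn⟩
      enc_inj := fun j j' f hf f' hf' h => by
        have := en.injective h
        simpa [hf, hf'] using this
      w_root := hw
      w_inj := hinj }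
  refine ⟨S, m, fun i => Label.column (hkpos (m i)), u, hm, ⟨fun i => rfl, hu0, hu1, fun i j => ?_,
    fun i l => ?_⟩, fun g => (hF.folner.tendsto_ncard g).comp hm.tendsto_atTop, fun i => E (m i),
    fun i => E' (m i), fun i => Label.fst, fun i => Label.snd, hc1, hc2, fun i => rfl,
    fun i => subset_rfl⟩
  · convert hclose i j using 6
    unfold TileSystem.count
    congr
  -- Every index occurs in the root tile of level `i + 1`, hence in `base`.
  · obtain ⟨d, hd, hl⟩ := hall i l
    refine ⟨w i none d, hl, shift d⁻¹ S.base, S.subshift.shift_mem _ _ S.base_mem, ?_⟩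
    rw [S.tile_shift]
    have : S.Tile i S.base (1 * d) (S.w i (S.root (i + 1)) d) := S.tile_base (i + 1) d hd
    simpa using this

theorem mainTheorem4 {G : Type*} [Group G] [Infinite G] [Countable G]
    (F : ℕ → Finset G) (hF : IsCongruentMonotileSeq F)
    (k : ℕ → ℕ) (M : ∀ n, Matrix (Fin (k n)) (Fin (k (n + 1))) ℕ)
    (hM : IsManaged (fun n => (F n).card) k M)
    (K : ℝ) (hK : 0 < K)
    (hk : ∀ n, (k (n + 1) : ℝ) ≤ K * (((F (n + 1)).card : ℝ) / ((F n).card : ℝ))) :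
    ∃ (m : ℕ) (X : Subshift G m),
      X.IsMinimal ∧
      (∃ S : Set X.carrier, X.IsFullMeasure S ∧ X.IsFreeOn S) ∧
      (IsVirtuallyAbelian G → X.IsFreeOn Set.univ) ∧
      AffinelyHomeomorphic X.invariantMeasures
        (inverseLimit (fun n => (F n).card) k M) := by
  obtain ⟨Γ, hn, hfi, hΓ⟩ : ∃ Γ : Subgroup G, Γ.Normal ∧ Γ.FiniteIndex ∧
      (IsVirtuallyAbelian G → ∀ a ∈ Γ, ∀ b ∈ Γ, a * b = b * a) := by
    by_cases h : IsVirtuallyAbelian G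
    · obtain ⟨Γ, hfi, hab⟩ := h
      exact ⟨Γ.normalCore, inferInstance, inferInstance, fun _ a ha b hb =>
        hab a (Γ.normalCore_le ha) b (Γ.normalCore_le hb)⟩
    -- Without an abelian subgroup of finite index, trivial colours suffice for the other
    -- conclusions.
    · exact ⟨⊤, inferInstance, inferInstance, fun h' => absurd h' h⟩
  obtain ⟨S, m, ρ, u, hm, hR, hFol, E, E', col, col', hc, hc', hE, hEE⟩ :=
    exists_tileSystem hF hM hk Γ
  refine ⟨S.alph, S.subshift, S.isMinimal_subshift, S.isFullMeasure_isFreeOn hFol,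
    fun hva x _ g hg => ?_, hR.affinelyHomeomorphic hFol hM
      (fun n => Finset.card_pos.2 ⟨1, hF.congruent.one_mem n⟩) hm⟩
  have hgx : shift g x.1 = x.1 := congrArg Subtype.val hg
  have hgΓ := S.mem_of_shift_eq Γ hc hc' hE hEE x.2 hgx
  exact S.eq_one_of_finite_conj x.2
    (TileSystem.finite_conj_of_commute (Γ := Γ) fun a ha => hΓ hva a ha g hgΓ) hgx
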